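/- Setting. For a finite node set $V$ with $|V|=N\in\mathbb N$, a dynamic graph sequence of length $T$ is $\mathcal S=(G_1,\dots,G_T)$ with $G_t=(V,E_t)$ simple graphs, $E_0=\emptyset$, and $|E_{t-1}\,\triangle\,E_t|\le 1$ for all $t\in[T]$. Two such sequences (with edge sets $E_t$ and $E'_t$) are item-level edge-neighboring if there is one edge $e^*$ with $(E_t\setminus E_{t-1})\setminus\{e^*\}=(E'_t\setminus E'_{t-1})\setminus\{e^*\}$ and $(E_{t-1}\setminus E_t)\setminus\{e^*\}=(E'_{t-1}\setminus E'_t)\setminus\{e^*\}$ for all $t\in[T]$. A continual release algorithm $\mathcal A$ is randomized and outputs at each time $t\in[T]$ a vector $a_t\in\mathbb R^k$ produced from $G_1,\dots,G_t$ only. It is item-level $(\varepsilon,\delta)$-edge-DP if $\Pr[\mathcal A(\mathcal S)\in \mathrm{Out}]\le e^{\varepsilon}\Pr[\mathcal A(\mathcal S')\in \mathrm{Out}]+\delta$ for all item-level edge-neighboring $\mathcal S,\mathcal S'$ and all measurable $\mathrm{Out}\subseteq(\mathbb R^k)^T$, where $\mathcal A(\mathcal S)=(a_1,\dots,a_T)$.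 It is $(\alpha,\beta)$-accurate for $f$ on $\mathcal S$ if $\Pr[\max_{t\in[T]}\|a_t-f(G_t)\|_\infty>\alpha]\le\beta$. Statement. Let $f$ be one of the following functions: the size of a maximum matching; the number of connected components; $\mathsf{HighDegree}_\tau$, the number of nodes of degree at least $\tau$, for a fixed integer $\tau\ge 1$; the degree histogram $(h_0,\dots,h_{N-1})$, where $h_j$ is the number of nodes of degree $j$. There is a constant $c>0$ depending only on $f$ (thus possibly on $\tau$) such that the following holds. 1. For every function $\delta:\mathbb N\to(0,1)$ with $\delta(T)=o(1/T)$ there are $T_0,N_0$ such that for all $T\ge T_0$, $N\ge N_0$ and $\varepsilon\in(0,1]$, every item-level $(\varepsilon,\delta(T))$-edge-DP algorithm that is $(\alpha,\tfrac13)$-accurate for $f$ on all dynamic graph sequences with $N$ nodes and length $T$ satisfies $$\alpha\ \ge\ c\cdot\min\left(\frac{T^{1/3}}{\varepsilon^{2/3}\log_2^{2/3}T},\;T,\;N\right).$$ 2. There are $T_0,N_0$ such that for all $T\ge T_0$, $N\ge N_0$ and $\varepsilon\in(0,1]$, every item-level $(\varepsilon,0)$-edge-DP algorithm that is $(\alpha,\tfrac13)$-accurate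 for $f$ on all dynamic graph sequences with $N$ nodes and length $T$ satisfies $$\alpha\ \ge\ c\cdot\min\left(\sqrt{\frac{T}{\varepsilon}},\;T,\;N\right).$$ -/

import Mathlib

open MeasureTheory

namespace DynamicGraphDP

/-- A dynamic graph sequence of length `T` on the node set `V`: graphs `G₀, G₁, …, G_T` on `V`,
where `G₀` has no edges and consecutive edge sets differ in at most one element.
The index `t : Fin T` stands for the time step `t + 1`, at which the graph is
`graph t.succ` and the previous graph is `graph t.castSucc`. -/
structure DynGraphSeq (V : Type*) (T : ℕ) where
  graph : Fin (T + 1) → SimpleGraph V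
  graph_zero : graph 0 = ⊥
  step : ∀ t : Fin T,
    (symmDiff (graph t.castSucc).edgeSet (graph t.succ).edgeSet).encard ≤ 1

namespace DynGraphSeq

variable {V : Type*} {T : ℕ}

/-- The edges inserted at a time step. -/
def inserted (S : DynGraphSeq V T) (t : Fin T) : Set (Sym2 V) :=
  (S.graph t.succ).edgeSet \ (S.graph t.castSucc).edgeSet

/-- The edges deleted at a time step. -/
def deleted (S : DynGraphSeq V T) (t : Fin T) : Set (Sym2 V) :=
  (S.graph t.castSucc).edgeSet \ (S.graph t.succ).edgeSet

/-- Item-level edge-neighboring sequences: apart from the updates pertaining to one edge `e`,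
they have the same insertions and the same deletions at every time step. -/
def ItemNeighboring (S S' : DynGraphSeq V T) : Prop :=
  ∃ e : Sym2 V, ∀ t : Fin T,
    S.inserted t \ {e} = S'.inserted t \ {e} ∧ S.deleted t \ {e} = S'.deleted t \ {e}

end DynGraphSeq

/-- A (randomized) continual release graph algorithm with outputs in `ℝ^k`, given by the joint law
of its outputs `(a₁, …, a_T)` on each input sequence. The outputs up to a time step are produced
from the graphs up to that time step only, so their joint law depends on these graphs only. -/
structure ContinualAlg (V : Type*) (T k : ℕ) where
  law : DynGraphSeq V T → Measure (Fin T → Fin k → ℝ)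
  prob : ∀ S, IsProbabilityMeasure (law S)
  causal : ∀ (t : Fin T) (S S' : DynGraphSeq V T),
    (∀ s : Fin (T + 1), s ≤ t.succ → S.graph s = S'.graph s) →
      (law S).map (Set.Iic t).domRestrict = (law S').map (Set.Iic t).domRestrict

namespace ContinualAlg

variable {V : Type*} {T k : ℕ}

/-- Item-level `(ε, δ)`-edge differential privacy. -/
def ItemLevelDP (A : ContinualAlg V T k) (ε δ : ℝ) : Prop :=
  ∀ S S' : DynGraphSeq V T, S.ItemNeighboring S' →
    ∀ Out : Set (Fin T → Fin k → ℝ), MeasurableSet Out →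
      (A.law S).real Out ≤ Real.exp ε * (A.law S').real Out + δ

/-- `(α, β)`-accuracy for `f` on the sequence `S`; the norm on `Fin k → ℝ` is the maximum norm. -/
def AccurateOn (A : ContinualAlg V T k) (f : SimpleGraph V → Fin k → ℝ) (α β : ℝ)
    (S : DynGraphSeq V T) : Prop :=
  (A.law S).real {a | ∃ t : Fin T, α < ‖a t - f (S.graph t.succ)‖} ≤ β

end ContinualAlg

/-- The size of a maximum matching. -/
noncomputable def maxMatchingSize {V : Type*} (G : SimpleGraph V) : ℕ :=
  sSup {m : ℕ | ∃ M : G.Subgraph, M.IsMatching ∧ M.edgeSet.ncard = m}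

/-- The number of connected components. -/
noncomputable def numComponents {V : Type*} (G : SimpleGraph V) : ℕ :=
  Nat.card G.ConnectedComponent

open Classical in
/-- The number of nodes of degree at least `τ`. -/
noncomputable def numHighDegree {V : Type*} [Fintype V] (τ : ℕ) (G : SimpleGraph V) : ℕ :=
  (Finset.univ.filter fun v : V => τ ≤ G.degree v).card

open Classical in
/-- The number of nodes of degree exactly `j`. -/
noncomputable def numOfDegree {V : Type*} [Fintype V] (j : ℕ) (G : SimpleGraph V) : ℕ :=
  (Finset.univ.filter fun v : V => G.degree v = j).card

/-- The graph problems considered; `highDegree τ` is available for positive thresholds `τ`. -/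
inductive GraphProblem where
  | maximumMatching
  | connectedComponents
  | highDegree (τ : ℕ+)
  | degreeHistogram

namespace GraphProblem

/-- The dimension of the output on graphs with `N` nodes. -/
def dim : GraphProblem → ℕ → ℕ
  | degreeHistogram, N => N
  | _, _ => 1

/-- The function to be estimated, on graphs with node set `Fin N`. The degree histogram is
`(h₀, …, h_{N-1})`; the other functions are scalar, seen as vectors of length one. -/
noncomputable def value : (p : GraphProblem) → (N : ℕ) → SimpleGraph (Fin N) → Fin (p.dim N) → ℝ
  | maximumMatching, _, G => fun _ => (maxMatchingSize G : ℝ)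
  | connectedComponents, _, G => fun _ => (numComponents G : ℝ)
  | highDegree τ, _, G => fun _ => (numHighDegree (τ : ℕ) G : ℝ)
  | degreeHistogram, _, G => fun j => (numOfDegree (j : ℕ) G : ℝ)

end GraphProblem

end DynamicGraphDP

/-! Both bounds come from turning a continual release algorithm into a private mechanism for
counting queries. Fix `M` disjoint stars with `g` leaves (`g = τ` for high degree, `g = 1`
otherwise). If the stars in `X` are present, some coordinate of `f` equals `a + b * |X|` with `|b| ≥
1`. Time is cut into `d` phases of length `2 * M * g`. Phase `j` builds the stars in `X j` edge by
edge, and its midpoint reveals `|X j|`; the second half removes them. Item-level privacy protects an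
edge over all phases at once, so a star is a record taking part in `d` queries, at the price of
group privacy for `g` edges (`exists_countingMechanism`).

Pure privacy is handled by packing (`error_ge_of_pureDP`): with every `X j` empty or full, error
below `k / 2` separates `2 ^ d` inputs on `k` stars, all within `k * g` edge changes of each other.
This is impossible for `d ≈ 4 * k * g * ε`. Such a stream takes time of order `k ^ 2 * ε`, whence `k
≈ √(T / ε)`.

Approximate privacy is handled by fingerprinting (`fingerprinting_bound`). Each of `n` records is
copied `k ≈ 1 / ε` times, so a record is protected with a constant parameter. Columns are drawn from
a Pólya urn, and a record is scored by its correlation with the answers, centred given the other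
records. Accuracy forces a total expected score of order `d`; privacy bounds the score of one record
by order `√d`. Hence `d = R ^ 2 * n ^ 2` queries with `R` a large constant force an error of order
`n * k`. The time used is of order `n ^ 3 * k`, so `n * k ≈ T ^ (1/3) / ε ^ (2/3)`. This argument
loses no logarithm; the one in the theorem is discarded at the end. -/

namespace DynamicGraphDP

/-! ### Moments under finite product distributions. -/

section ProductWeights

variable {ι β : Type*} [Fintype ι] [DecidableEq ι] [Fintype β]

lemma sum_prod_weight {ρ : ι → β → ℝ} (hρ : ∀ j, ∑ b, ρ j b = 1) :
    ∑ z : ι → β, ∏ j, ρ j (z j) = 1 := by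
  rw [← Fintype.prod_sum]
  exact Finset.prod_eq_one fun j _ => hρ j

lemma sum_prod_weight_mul {ρ : ι → β → ℝ} (hρ : ∀ j, ∑ b, ρ j b = 1) (j₀ : ι) (h : β → ℝ) :
    ∑ z : ι → β, (∏ j, ρ j (z j)) * h (z j₀) = ∑ b, ρ j₀ b * h b := by
  -- Padding `h` with ones in the other coordinates makes the summand a product, so the sum
  -- factorises.
  have key : ∀ z : ι → β, (∏ j, ρ j (z j)) * h (z j₀)
      = ∏ j, (ρ j (z j) * if j = j₀ then h (z j) else 1) := by
    intro z
    rw [Finset.prod_mul_distrib, Finset.prod_ite_eq' Finset.univ j₀ (fun j => h (z j))]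
    simp
  simp_rw [key]
  rw [← Fintype.prod_sum (fun j b => ρ j b * if j = j₀ then h b else 1),
    Finset.prod_eq_single j₀]
  · simp
  · intro j _ hj
    simp [hj, hρ]
  · simp

lemma sum_prod_weight_mul_mul_eq_zero {ρ : ι → β → ℝ} {c : ι → β → ℝ}
    (hc : ∀ j, ∑ b, ρ j b * c j b = 0) {j k : ι} (hjk : j ≠ k) :
    ∑ z : ι → β, (∏ l, ρ l (z l)) * (c j (z j) * c k (z k)) = 0 := by
  have key : ∀ z : ι → β, (∏ l, ρ l (z l)) * (c j (z j) * c k (z k))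
      = ∏ l, (ρ l (z l) * ((if l = j then c l (z l) else 1) *
          (if l = k then c l (z l) else 1))) := by
    intro z
    rw [Finset.prod_mul_distrib, Finset.prod_mul_distrib,
      Finset.prod_ite_eq' Finset.univ j (fun l => c l (z l)),
      Finset.prod_ite_eq' Finset.univ k (fun l => c l (z l))]
    simp
  simp_rw [key]
  rw [← Fintype.prod_sum (fun l b => ρ l b * ((if l = j then c l b else 1) *
          (if l = k then c l b else 1)))]
  refine Finset.prod_eq_zero (Finset.mem_univ j) ?_
  simpa [hjk] using hc j

/-- The second moment of a sum of independent centred variables. -/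
lemma sum_prod_weight_mul_sq_le {ρ : ι → β → ℝ} {c : ι → β → ℝ} (hρ0 : ∀ j b, 0 ≤ ρ j b)
    (hρ : ∀ j, ∑ b, ρ j b = 1) (hc : ∀ j, ∑ b, ρ j b * c j b = 0) (hc1 : ∀ j b, |c j b| ≤ 1) :
    ∑ z : ι → β, (∏ j, ρ j (z j)) * (∑ j, c j (z j)) ^ 2 ≤ Fintype.card ι := by
  have expand : ∑ z : ι → β, (∏ j, ρ j (z j)) * (∑ j, c j (z j)) ^ 2
      = ∑ j, ∑ k, ∑ z : ι → β, (∏ l, ρ l (z l)) * (c j (z j) * c k (z k)) := by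
    simp_rw [pow_two, Finset.sum_mul_sum, Finset.mul_sum]
    rw [Finset.sum_comm]
    refine Finset.sum_congr rfl fun j _ => ?_
    rw [Finset.sum_comm]
  have diag : ∀ j, ∑ k, ∑ z : ι → β, (∏ l, ρ l (z l)) * (c j (z j) * c k (z k)) ≤ 1 := by
    intro j
    rw [Finset.sum_eq_single j (fun k _ hk => sum_prod_weight_mul_mul_eq_zero hc hk.symm)
      (by simp), sum_prod_weight_mul hρ j (fun b => c j b * c j b), ← hρ j]
    refine Finset.sum_le_sum fun b _ => mul_le_of_le_one_right (hρ0 j b) ?_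
    rw [← abs_mul_abs_self]
    exact mul_le_one₀ (hc1 j b) (abs_nonneg _) (hc1 j b)
  rw [expand]
  calc _ ≤ ∑ _j : ι, (1 : ℝ) := Finset.sum_le_sum fun j _ => diag j
    _ = _ := by simp

end ProductWeights

/-! ### The Pólya urn distribution of a column. -/

section Urn

variable {n : ℕ}

/-- The law of the set of drawn ones in `n` draws from a Pólya urn. -/
noncomputable def urnWeight (x : Finset (Fin n)) : ℝ := 1 / ((n + 1) * (n.choose x.card : ℝ))

/-- The conditional probability of a one in draw `i`, given the other draws. -/
noncomputable def urnProb (i : Fin n) (x : Finset (Fin n)) : ℝ := ((x.erase i).card + 1) / (n + 1)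

/-- The conditional law of draw `i`, given the other draws. -/
noncomputable def urnCond (i : Fin n) (x : Finset (Fin n)) (b : Bool) : ℝ :=
  if b then urnProb i x else 1 - urnProb i x

/-- The set `x` with the membership of `i` redefined as `b`. -/
def setMem (i : Fin n) (b : Bool) (x : Finset (Fin n)) : Finset (Fin n) :=
  if b then insert i x else x.erase i

lemma urnWeight_pos (x : Finset (Fin n)) : 0 < urnWeight x := by
  have h : 0 < n.choose x.card := Nat.choose_pos (by simpa using x.card_le_univ)
  unfold urnWeight
  positivity

/-- The number of ones is uniform on `{0, …, n}`, and given this number all sets are equally likely.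
-/
lemma sum_urnWeight_mul (φ : ℕ → ℝ) :
    ∑ x : Finset (Fin n), urnWeight x * φ x.card = (∑ s ∈ Finset.range (n + 1), φ s) / (n + 1) := by
  have h := Finset.sum_powerset_apply_card
    (fun s => 1 / ((n + 1) * (n.choose s : ℝ)) * φ s) (x := (Finset.univ : Finset (Fin n)))
  rw [Finset.powerset_univ] at h
  unfold urnWeight
  rw [h, Finset.sum_div]
  simp only [Finset.card_univ, Fintype.card_fin]
  refine Finset.sum_congr rfl fun s hs => ?_
  have h : 0 < n.choose s := Nat.choose_pos (Nat.lt_succ_iff.1 (Finset.mem_range.1 hs))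
  have h' : (n.choose s : ℝ) ≠ 0 := by positivity
  rw [nsmul_eq_mul]
  field_simp

lemma sum_urnWeight : ∑ x : Finset (Fin n), urnWeight x = 1 := by
  have h := sum_urnWeight_mul (n := n) fun _ => 1
  simp only [mul_one, Finset.sum_const, Finset.card_range, nsmul_eq_mul] at h
  rw [h]
  push_cast
  exact div_self (by positivity)

lemma card_erase_eq (i : Fin n) (x : Finset (Fin n)) :
    ((x.erase i).card : ℝ) = x.card - if i ∈ x then 1 else 0 := by
  split_ifs with h
  · rw [Finset.cast_card_erase_of_mem h]
  · rw [Finset.erase_eq_of_notMem h, sub_zero]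

/-- The conditional probabilities are pulled slightly towards one half, so after centring each
record a fixed share of the imbalance of the column survives. As this holds for every column,
correlation with accurate answers needs no averaging over the column. -/
lemma sum_mem_sub_urnProb (x : Finset (Fin n)) :
    ∑ i, ((if i ∈ x then 1 else 0) - urnProb i x) = (2 * x.card - n : ℝ) / (n + 1) := by
  have h : ∑ i : Fin n, (if i ∈ x then (1 : ℝ) else 0) = x.card := by simp
  simp only [urnProb, card_erase_eq]
  rw [Finset.sum_sub_distrib, ← Finset.sum_div, Finset.sum_add_distrib, Finset.sum_sub_distrib, h]
  simp only [Finset.sum_const, Finset.card_univ, Fintype.card_fin, nsmul_eq_mul]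
  field_simp
  ring

lemma urnProb_nonneg (i : Fin n) (x : Finset (Fin n)) : 0 ≤ urnProb i x := by
  unfold urnProb; positivity

lemma urnProb_le_one (i : Fin n) (x : Finset (Fin n)) : urnProb i x ≤ 1 := by
  unfold urnProb
  rw [div_le_one (by positivity)]
  have : (x.erase i).card ≤ n := by simpa using (x.erase i).card_le_univ
  exact_mod_cast Nat.succ_le_succ this

lemma urnCond_nonneg (i : Fin n) (x : Finset (Fin n)) (b : Bool) : 0 ≤ urnCond i x b := by
  unfold urnCond
  split_ifs
  · exact urnProb_nonneg i x
  · linarith [urnProb_le_one i x]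

lemma sum_urnCond (i : Fin n) (x : Finset (Fin n)) : ∑ b, urnCond i x b = 1 := by
  simp [urnCond]

lemma erase_setMem (i : Fin n) (b : Bool) (x : Finset (Fin n)) :
    (setMem i b x).erase i = x.erase i := by
  cases b <;> simp [setMem]

lemma mem_setMem (i : Fin n) (b : Bool) (x : Finset (Fin n)) : i ∈ setMem i b x ↔ b = true := by
  cases b <;> simp [setMem]

lemma setMem_setMem (i : Fin n) (b : Bool) (x : Finset (Fin n)) :
    setMem i (decide (i ∈ x)) (setMem i b x) = x := by
  by_cases h : i ∈ x <;> cases b <;> simp [setMem, h]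

lemma urnProb_setMem (i : Fin n) (b : Bool) (x : Finset (Fin n)) :
    urnProb i (setMem i b x) = urnProb i x := by
  unfold urnProb; rw [erase_setMem]

/-- Detailed balance for draw `i`; it reduces to the recurrence between consecutive binomial
coefficients. -/
lemma urnWeight_mul_insert {i : Fin n} {x : Finset (Fin n)} (h : i ∉ x) :
    urnWeight x * urnProb i x = urnWeight (insert i x) * (1 - urnProb i x) := by
  have hlt : x.card < n := by
    have := Finset.card_lt_univ_of_notMem h
    simpa using this
  have h1 : (n.choose (x.card + 1) : ℝ) * (x.card + 1) = n.choose x.card * (n - x.card) := by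
    have := Nat.choose_succ_right_eq n x.card
    rw [← Nat.cast_sub hlt.le]
    exact_mod_cast this
  have p1 : (n.choose x.card : ℝ) ≠ 0 := by
    have := Nat.choose_pos hlt.le
    positivity
  have p2 : (n.choose (x.card + 1) : ℝ) ≠ 0 := by
    have := Nat.choose_pos (Nat.succ_le_of_lt hlt)
    positivity
  unfold urnWeight urnProb
  rw [Finset.erase_eq_of_notMem h, Finset.card_insert_of_notMem h]
  field_simp
  linear_combination h1

/-- Reversibility of redrawing `i`. -/
lemma urn_balance (i : Fin n) (x : Finset (Fin n)) (b : Bool) :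
    urnWeight x * urnCond i x b
      = urnWeight (setMem i b x) * urnCond i (setMem i b x) (decide (i ∈ x)) := by
  unfold urnCond
  rw [urnProb_setMem]
  by_cases h : i ∈ x <;> cases b
  · have := urnWeight_mul_insert (Finset.notMem_erase i x)
    rw [Finset.insert_erase h] at this
    have e : urnProb i (x.erase i) = urnProb i x := urnProb_setMem i false x
    rw [e] at this
    simp [h, setMem, this]
  · simp [setMem, h]
  · simp [setMem, h]
  · simp [setMem, h, urnWeight_mul_insert h]

/-- Under the Pólya urn, the fraction of ones is bounded away from one half with
probability at least one half. -/
lemma half_le_sum_urnWeight_heavy :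
    1 / 2 ≤ ∑ x : Finset (Fin n), urnWeight x *
      (if 4 * x.card ≤ n ∨ 3 * n ≤ 4 * x.card then 1 else 0) := by
  rw [sum_urnWeight_mul (fun s => if 4 * s ≤ n ∨ 3 * n ≤ 4 * s then 1 else 0), le_div_iff₀
    (by positivity), Finset.sum_boole]
  rcases Nat.eq_zero_or_pos n with rfl | hn
  · norm_num
  set S := (Finset.range (n + 1)).filter fun s => 4 * s ≤ n ∨ 3 * n ≤ 4 * s
  -- The two tails hold `2 * (n / 4 + 1)` of the `n + 1` sizes. They are disjoint only for `n > 0`,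
  -- hence the separate case above.
  have hsub : Finset.range (n / 4 + 1) ∪ Finset.Icc (n - n / 4) n ⊆ S := by
    intro s hs
    simp only [S, Finset.mem_union, Finset.mem_range, Finset.mem_Icc, Finset.mem_filter] at hs ⊢
    omega
  have hdis : Disjoint (Finset.range (n / 4 + 1)) (Finset.Icc (n - n / 4) n) := by
    rw [Finset.disjoint_left]
    intro s hs
    simp only [Finset.mem_range, Finset.mem_Icc] at hs ⊢
    omega
  have hcard := Finset.card_le_card hsub
  rw [Finset.card_union_of_disjoint hdis, Finset.card_range, Nat.card_Icc] at hcard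
  have : n + 1 ≤ 2 * S.card := by omega
  have : ((n + 1 : ℕ) : ℝ) ≤ 2 * S.card := by exact_mod_cast this
  push_cast at this
  linarith

end Urn

/-! ### Fingerprinting lower bound for counting queries. -/

/-- An approximate-privacy inequality on events extends to bounded non-negative functions. -/
lemma integral_le_of_measureReal_le {Y : Type*} [MeasurableSpace Y] {μ ν : Measure Y}
    [IsProbabilityMeasure μ] [IsProbabilityMeasure ν] {C δ B : ℝ} (hB : 0 ≤ B)
    (h : ∀ O, MeasurableSet O → μ.real O ≤ C * ν.real O + δ) {g : Y → ℝ} (hg : Measurable g)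
    (hg0 : ∀ y, 0 ≤ g y) (hgB : ∀ y, g y ≤ B) :
    ∫ y, g y ∂μ ≤ C * ∫ y, g y ∂ν + B * δ := by
  have int : ∀ (κ : Measure Y) [IsProbabilityMeasure κ], Integrable g κ := fun κ _ =>
    Integrable.of_bound hg.aestronglyMeasurable B
      (.of_forall fun y => by rw [Real.norm_of_nonneg (hg0 y)]; exact hgB y)
  have int' : ∀ (κ : Measure Y) [IsProbabilityMeasure κ],
      IntegrableOn (fun t => κ.real {a | t ≤ g a}) (Set.Ioc 0 B) := by
    intro κ _
    have hanti : Antitone fun t => κ.real {a | t ≤ g a} := fun s t hst =>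
      measureReal_mono fun a (ha : t ≤ g a) => hst.trans ha
    exact Integrable.of_bound hanti.measurable.aestronglyMeasurable 1
      (.of_forall fun t => by
        rw [Real.norm_of_nonneg measureReal_nonneg]; exact measureReal_le_one)
  -- Layer cake formula: the inequality is applied to each superlevel set and integrated over levels
  -- in `(0, B]`.
  rw [(int μ).integral_eq_integral_Ioc_meas_le (.of_forall hg0) (.of_forall hgB),
    (int ν).integral_eq_integral_Ioc_meas_le (.of_forall hg0) (.of_forall hgB)]
  have hc : ∫ _t in Set.Ioc 0 B, δ = B * δ := by simp [hB]
  rw [← hc, ← integral_const_mul, ← integral_add ((int' ν).const_mul C) (by simp)]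
  refine integral_mono (int' μ) (((int' ν).const_mul C).add (by simp)) fun t => ?_
  exact h _ (measurableSet_le measurable_const hg)

section Fingerprint

variable {n d : ℕ}

/-- The correlation of the answers `v` with record `i`, centred given the other records. -/
noncomputable def traceScore (i : Fin n) (X : Fin d → Finset (Fin n)) (v : Fin d → ℝ) : ℝ :=
  ∑ j, v j * ((if i ∈ X j then 1 else 0) - urnProb i (X j))

/-- The dataset `X` with record `i` replaced by `z`. -/
def setRow (i : Fin n) (z : Fin d → Bool) (X : Fin d → Finset (Fin n)) : Fin d → Finset (Fin n) :=
  fun j => setMem i (z j) (X j)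

lemma abs_traceScore_le (i : Fin n) (X : Fin d → Finset (Fin n)) {v : Fin d → ℝ}
    (hv : ∀ j, |v j| ≤ 1) : |traceScore i X v| ≤ d := by
  calc |traceScore i X v| ≤ ∑ j, |v j * ((if i ∈ X j then 1 else 0) - urnProb i (X j))| :=
        Finset.abs_sum_le_sum_abs _ _
    _ ≤ ∑ _j : Fin d, (1 : ℝ) := by
        refine Finset.sum_le_sum fun j _ => ?_
        rw [abs_mul]
        refine mul_le_one₀ (hv j) (abs_nonneg _) ?_
        have h0 := urnProb_nonneg i (X j)
        have h1 := urnProb_le_one i (X j)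
        rw [abs_le]
        split_ifs <;> constructor <;> linarith
    _ = d := by simp

lemma sum_traceScore (X : Fin d → Finset (Fin n)) (v : Fin d → ℝ) :
    ∑ i, traceScore i X v = ∑ j, v j * ((2 * (X j).card - n : ℝ) / (n + 1)) := by
  unfold traceScore
  rw [Finset.sum_comm]
  exact Finset.sum_congr rfl fun j _ => by rw [← Finset.mul_sum, sum_mem_sub_urnProb]

/-- Against answers that do not depend on the redrawn record, the score is small. -/
lemma sum_urnCond_mul_max_traceScore_le {r : ℝ} (hr : 0 < r) (hd : (d : ℝ) = r ^ 2) (i : Fin n)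
    (X : Fin d → Finset (Fin n)) {v : Fin d → ℝ} (hv : ∀ j, |v j| ≤ 1) :
    ∑ z : Fin d → Bool, (∏ j, urnCond i (X j) (z j)) * max (traceScore i (setRow i z X) v) 0
      ≤ r := by
  set c : Fin d → Bool → ℝ := fun j b => v j * ((if b then 1 else 0) - urnProb i (X j))
  have hs : ∀ z, traceScore i (setRow i z X) v = ∑ j, c j (z j) := fun z =>
    Finset.sum_congr rfl fun j _ => by
      simp only [c, setRow, urnProb_setMem, mem_setMem]
  have hc : ∀ j, ∑ b, urnCond i (X j) b * c j b = 0 := fun j => by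
    simp only [Fintype.sum_bool, urnCond, c]
    simp only [if_true, Bool.false_eq_true, if_false]
    ring
  have hc1 : ∀ j b, |c j b| ≤ 1 := fun j b => by
    simp only [c]
    rw [abs_mul]
    refine mul_le_one₀ (hv j) (abs_nonneg _) ?_
    have h0 := urnProb_nonneg i (X j)
    have h1 := urnProb_le_one i (X j)
    rw [abs_le]
    split_ifs <;> constructor <;> linarith
  have hm := sum_prod_weight_mul_sq_le (fun j b => urnCond_nonneg i (X j) b)
    (fun j => sum_urnCond i (X j)) hc hc1
  rw [Fintype.card_fin, hd] at hm
  have h1 := sum_prod_weight (fun j => sum_urnCond i (X j))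
  -- This AM-GM form stands in for Cauchy–Schwarz: with second moment at most `r ^ 2`, both terms
  -- average to at most `r / 2`.
  have hmax : ∀ a : ℝ, max a 0 ≤ a ^ 2 * (1 / (2 * r)) + r / 2 := fun a => by
    have h : a ^ 2 * (1 / (2 * r)) + r / 2 - a = (a - r) ^ 2 * (1 / (2 * r)) := by
      field_simp
      ring
    refine max_le ?_ (by positivity)
    have : 0 ≤ (a - r) ^ 2 * (1 / (2 * r)) := by positivity
    linarith
  calc _ ≤ ∑ z : Fin d → Bool, (∏ j, urnCond i (X j) (z j)) *
        ((∑ j, c j (z j)) ^ 2 * (1 / (2 * r)) + r / 2) := by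
        refine Finset.sum_le_sum fun z _ => mul_le_mul_of_nonneg_left ?_
          (Finset.prod_nonneg fun j _ => urnCond_nonneg _ _ _)
        rw [hs]
        exact hmax _
    _ = (∑ z : Fin d → Bool, (∏ j, urnCond i (X j) (z j)) * (∑ j, c j (z j)) ^ 2) *
          (1 / (2 * r)) + (∑ z : Fin d → Bool, ∏ j, urnCond i (X j) (z j)) * (r / 2) := by
        rw [Finset.sum_mul, Finset.sum_mul, ← Finset.sum_add_distrib]
        exact Finset.sum_congr rfl fun z _ => by ring
    _ ≤ r ^ 2 * (1 / (2 * r)) + 1 * (r / 2) := by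
        rw [h1]
        gcongr
    _ = r := by field_simp; ring

/-- The joint law of the dataset and a redrawn dataset is symmetric. -/
lemma sum_urn_swap (i : Fin n) (F : (Fin d → Finset (Fin n)) → (Fin d → Finset (Fin n)) → ℝ) :
    ∑ X : Fin d → Finset (Fin n), ∑ z : Fin d → Bool,
        (∏ j, urnWeight (X j)) * (∏ j, urnCond i (X j) (z j)) * F X (setRow i z X)
      = ∑ X : Fin d → Finset (Fin n), ∑ z : Fin d → Bool,
        (∏ j, urnWeight (X j)) * (∏ j, urnCond i (X j) (z j)) * F (setRow i z X) X := by
  -- The involution exchanges the new row with the old one, remembering the old memberships;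
  -- `urn_balance` says that it preserves the weights.
  set e : (Fin d → Finset (Fin n)) × (Fin d → Bool) → (Fin d → Finset (Fin n)) × (Fin d → Bool) :=
    fun p => (setRow i p.2 p.1, fun j => decide (i ∈ p.1 j)) with he
  have inv : Function.Involutive e := by
    rintro ⟨X, z⟩
    simp only [he, setRow, Prod.mk.injEq]
    constructor
    · funext j; exact setMem_setMem i (z j) (X j)
    · funext j; simp [mem_setMem]
  rw [← Fintype.sum_prod_type', ← Fintype.sum_prod_type', ← Equiv.sum_comp inv.toPerm]
  refine Finset.sum_congr rfl fun p _ => ?_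
  rw [Function.Involutive.coe_toPerm]
  have hinv : setRow i (e p).2 (e p).1 = p.1 := congrArg Prod.fst (inv p)
  rw [hinv, ← Finset.prod_mul_distrib, ← Finset.prod_mul_distrib]
  congr 1
  exact Finset.prod_congr rfl fun j _ => (urn_balance i (p.1 j) (p.2 j)).symm

variable {Y : Type*} [MeasurableSpace Y]

lemma measurable_traceScore {f : Y → Fin d → ℝ} (hf : Measurable f) (i : Fin n)
    (X : Fin d → Finset (Fin n)) : Measurable fun y => traceScore i X (f y) := by
  unfold traceScore
  exact Finset.measurable_sum _ fun j _ => ((measurable_pi_apply j).comp hf).mul_const _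

lemma integrable_max_traceScore {f : Y → Fin d → ℝ} (hf : Measurable f)
    (hf1 : ∀ y j, |f y j| ≤ 1) (i : Fin n) (X : Fin d → Finset (Fin n)) (ν : Measure Y)
    [IsProbabilityMeasure ν] : Integrable (fun y => max (traceScore i X (f y)) 0) ν := by
  refine Integrable.of_bound ((measurable_traceScore hf i X).max measurable_const
    ).aestronglyMeasurable d (.of_forall fun y => ?_)
  rw [Real.norm_of_nonneg (le_max_right _ _)]
  exact max_le ((le_abs_self _).trans (abs_traceScore_le i X (hf1 y))) (by positivity)

/-- Under privacy, no record is correlated with the answers. -/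
lemma sum_urnWeight_mul_integral_traceScore_le {r C δ : ℝ} (hr : 0 < r) (hd : (d : ℝ) = r ^ 2)
    (hC : 0 ≤ C) (μ : (Fin d → Finset (Fin n)) → Measure Y) [∀ X, IsProbabilityMeasure (μ X)]
    {f : Y → Fin d → ℝ} (hf : Measurable f) (hf1 : ∀ y j, |f y j| ≤ 1) (i : Fin n)
    (hDP : ∀ X X', (∀ j, (X j).erase i = (X' j).erase i) → ∀ O, MeasurableSet O →
      (μ X).real O ≤ C * (μ X').real O + δ) :
    ∑ X, (∏ j, urnWeight (X j)) * ∫ y, max (traceScore i X (f y)) 0 ∂(μ X) ≤ C * r + d * δ := by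
  set F : (Fin d → Finset (Fin n)) → (Fin d → Finset (Fin n)) → ℝ :=
    fun X X' => ∫ y, max (traceScore i X (f y)) 0 ∂(μ X') with hF
  have hW : ∀ X : Fin d → Finset (Fin n), 0 ≤ ∏ j, urnWeight (X j) := fun X =>
    Finset.prod_nonneg fun j _ => (urnWeight_pos _).le
  have hπ : ∀ (X : Fin d → Finset (Fin n)) (z : Fin d → Bool), 0 ≤ ∏ j, urnCond i (X j) (z j) :=
    fun X z => Finset.prod_nonneg fun j _ => urnCond_nonneg _ _ _
  have hW1 : ∑ X : Fin d → Finset (Fin n), ∏ j, urnWeight (X j) = 1 :=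
    sum_prod_weight fun _ => sum_urnWeight
  have hπ1 : ∀ X : Fin d → Finset (Fin n), ∑ z : Fin d → Bool, ∏ j, urnCond i (X j) (z j) = 1 :=
    fun X => sum_prod_weight fun j => sum_urnCond i (X j)
  -- Privacy moves the answers to the dataset with a redrawn row. After the swap below, the answers
  -- come from `X` and the score from an independent redraw. Positive parts are used because the
  -- privacy inequality extends only to non-negative functions.
  have step : ∀ X z, F X X ≤ C * F X (setRow i z X) + d * δ := fun X z =>
    integral_le_of_measureReal_le (by positivity)
      (hDP X (setRow i z X) fun j => (erase_setMem i (z j) (X j)).symm)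
      ((measurable_traceScore hf i X).max measurable_const) (fun _ => le_max_right _ _)
      fun y => max_le ((le_abs_self _).trans (abs_traceScore_le i X (hf1 y))) (by positivity)
  have out : ∀ X, ∑ z : Fin d → Bool, (∏ j, urnCond i (X j) (z j)) * F (setRow i z X) X ≤ r := by
    intro X
    have e : ∑ z : Fin d → Bool, (∏ j, urnCond i (X j) (z j)) * F (setRow i z X) X
        = ∫ y, ∑ z : Fin d → Bool, (∏ j, urnCond i (X j) (z j)) *
            max (traceScore i (setRow i z X) (f y)) 0 ∂(μ X) := by
      rw [integral_finsetSum _ fun z _ =>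
        (integrable_max_traceScore hf hf1 i (setRow i z X) (μ X)).const_mul _]
      exact Finset.sum_congr rfl fun z _ => (integral_const_mul _ _).symm
    rw [e]
    calc _ ≤ ∫ _y, r ∂(μ X) := by
          refine integral_mono (integrable_finsetSum _ fun z _ =>
            (integrable_max_traceScore hf hf1 i (setRow i z X) (μ X)).const_mul _)
            (integrable_const r) fun y => ?_
          exact sum_urnCond_mul_max_traceScore_le hr hd i X (hf1 y)
      _ = r := by simp
  calc ∑ X, (∏ j, urnWeight (X j)) * F X X
      = ∑ X, ∑ z : Fin d → Bool,
          (∏ j, urnWeight (X j)) * (∏ j, urnCond i (X j) (z j)) * F X X := by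
        refine Finset.sum_congr rfl fun X _ => ?_
        rw [← Finset.sum_mul, ← Finset.mul_sum, hπ1, mul_one]
    _ ≤ ∑ X, ∑ z : Fin d → Bool, (∏ j, urnWeight (X j)) * (∏ j, urnCond i (X j) (z j)) *
          (C * F X (setRow i z X) + d * δ) :=
        Finset.sum_le_sum fun X _ => Finset.sum_le_sum fun z _ =>
          mul_le_mul_of_nonneg_left (step X z) (mul_nonneg (hW X) (hπ X z))
    _ = C * (∑ X, ∑ z : Fin d → Bool, (∏ j, urnWeight (X j)) * (∏ j, urnCond i (X j) (z j)) *
          F X (setRow i z X)) + d * δ := by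
        have : ∑ X : Fin d → Finset (Fin n), ∑ z : Fin d → Bool,
            (∏ j, urnWeight (X j)) * (∏ j, urnCond i (X j) (z j)) * (d * δ) = d * δ := by
          simp_rw [← Finset.sum_mul, ← Finset.mul_sum, hπ1, mul_one]
          rw [hW1, one_mul]
        rw [← this, Finset.mul_sum, ← Finset.sum_add_distrib]
        refine Finset.sum_congr rfl fun X _ => ?_
        rw [Finset.mul_sum, ← Finset.sum_add_distrib]
        exact Finset.sum_congr rfl fun z _ => by rw [this]; ring
    _ = C * (∑ X, ∑ z : Fin d → Bool, (∏ j, urnWeight (X j)) * (∏ j, urnCond i (X j) (z j)) *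
          F (setRow i z X) X) + d * δ := by rw [sum_urn_swap]
    _ ≤ C * (∑ X : Fin d → Finset (Fin n), (∏ j, urnWeight (X j)) * r) + d * δ := by
        gcongr with X
        simp_rw [mul_assoc]
        rw [← Finset.mul_sum]
        exact mul_le_mul_of_nonneg_left (out X) (hW X)
    _ = C * r + d * δ := by rw [← Finset.sum_mul, hW1, one_mul]

/-- The number of columns in which the fraction of ones is far from one half. -/
def heavyCount (X : Fin d → Finset (Fin n)) : ℕ :=
  (Finset.univ.filter fun j => 4 * (X j).card ≤ n ∨ 3 * n ≤ 4 * (X j).card).card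

lemma mul_ge_of_close {v x : ℝ} (h : |v - x| ≤ 1 / 8) :
    x ^ 2 - |x| / 8 ≤ v * x := by
  have h1 : -((v - x) * x) ≤ |x| / 8 := by
    calc -((v - x) * x) ≤ |(v - x) * x| := neg_le_abs _
      _ = |v - x| * |x| := abs_mul _ _
      _ ≤ 1 / 8 * |x| := by gcongr
      _ = _ := by ring
  nlinarith

/-- Accurate answers are correlated with the records. -/
lemma sum_traceScore_ge (hn : 0 < n) (X : Fin d → Finset (Fin n)) {v : Fin d → ℝ}
    (hv : ∀ j, |v j - (2 * (X j).card - n : ℝ) / n| ≤ 1 / 8) :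
    (n / (n + 1) : ℝ) * (3 / 16 * heavyCount X - d / 256) ≤ ∑ i, traceScore i X v := by
  have hn' : (0 : ℝ) < n := by exact_mod_cast hn
  -- `x ^ 2 - |x| / 8` is at least `1/4 - 1/16 = 3/16` for `|x| ≥ 1/2`, and its minimum is `-1/256`,
  -- at `|x| = 1/16`.
  have key : ∀ j, (if 4 * (X j).card ≤ n ∨ 3 * n ≤ 4 * (X j).card then 3 / 16 else (0 : ℝ))
      - 1 / 256 ≤ v j * ((2 * (X j).card - n : ℝ) / n) := by
    intro j
    set x : ℝ := (2 * (X j).card - n : ℝ) / n with hx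
    refine le_trans ?_ (mul_ge_of_close (hv j))
    rw [← sq_abs x]
    split_ifs with h
    · have hx2 : 1 / 2 ≤ |x| := by
        rw [hx, abs_div, abs_of_pos hn', le_div_iff₀ hn']
        rcases h with h | h
        · have : (4 * (X j).card : ℝ) ≤ n := by exact_mod_cast h
          refine le_trans ?_ (neg_le_abs _)
          linarith
        · have : (3 * n : ℝ) ≤ 4 * (X j).card := by exact_mod_cast h
          refine le_trans ?_ (le_abs_self _)
          linarith
      nlinarith
    · nlinarith [sq_nonneg (|x| - 1 / 16)]
  have hsum := Finset.sum_le_sum fun j (_ : j ∈ Finset.univ) => key j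
  rw [Finset.sum_sub_distrib, ← Finset.sum_filter, Finset.sum_const, Finset.sum_const] at hsum
  simp only [nsmul_eq_mul, Finset.card_univ, Fintype.card_fin] at hsum
  rw [sum_traceScore]
  have e : ∑ j, v j * ((2 * (X j).card - n : ℝ) / (n + 1))
      = (n / (n + 1) : ℝ) * ∑ j, v j * ((2 * (X j).card - n : ℝ) / n) := by
    rw [Finset.mul_sum]
    refine Finset.sum_congr rfl fun j _ => ?_
    field_simp
  rw [e]
  refine mul_le_mul_of_nonneg_left ?_ (by positivity)
  refine le_trans (le_of_eq ?_) hsum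
  unfold heavyCount
  ring

lemma half_mul_le_sum_heavyCount :
    (d : ℝ) / 2 ≤ ∑ X : Fin d → Finset (Fin n), (∏ j, urnWeight (X j)) * heavyCount X := by
  have h : ∀ X : Fin d → Finset (Fin n), (heavyCount X : ℝ)
      = ∑ j, if 4 * (X j).card ≤ n ∨ 3 * n ≤ 4 * (X j).card then 1 else 0 := fun X => by
    rw [Finset.sum_boole]; rfl
  simp_rw [h, Finset.mul_sum]
  rw [Finset.sum_comm]
  calc (d : ℝ) / 2 = ∑ _j : Fin d, (1 / 2 : ℝ) := by simp; ring
    _ ≤ _ := Finset.sum_le_sum fun j _ => by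
        rw [sum_prod_weight_mul (fun _ => sum_urnWeight) j
          (fun x => if 4 * x.card ≤ n ∨ 3 * n ≤ 4 * x.card then (1 : ℝ) else 0)]
        exact half_le_sum_urnWeight_heavy

/-- A private mechanism that answers `d` counting queries on `n` records accurately
needs `n` to be at least of the order of the square root of `d`. -/
theorem fingerprinting_bound (hn : 0 < n) {r C δ : ℝ} (hr : 0 < r) (hd : (d : ℝ) = r ^ 2)
    (hC : 0 ≤ C) (μ : (Fin d → Finset (Fin n)) → Measure Y) [∀ X, IsProbabilityMeasure (μ X)]
    {f : Y → Fin d → ℝ} (hf : Measurable f) (hf1 : ∀ y j, |f y j| ≤ 1)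
    (hDP : ∀ i X X', (∀ j, (X j).erase i = (X' j).erase i) → ∀ O, MeasurableSet O →
      (μ X).real O ≤ C * (μ X').real O + δ)
    (hacc : ∀ X, (μ X).real {y | ∃ j, 1 / 8 < |f y j - (2 * (X j).card - n : ℝ) / n|} ≤ 1 / 3) :
    7 / 512 * d ≤ n * (C * r + d * δ) := by
  have hn' : (1 : ℝ) ≤ n := by exact_mod_cast hn
  have hW : ∀ X : Fin d → Finset (Fin n), 0 ≤ ∏ j, urnWeight (X j) := fun X =>
    Finset.prod_nonneg fun j _ => (urnWeight_pos _).le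
  have hW1 : ∑ X : Fin d → Finset (Fin n), ∏ j, urnWeight (X j) = 1 :=
    sum_prod_weight fun _ => sum_urnWeight
  have hd0 : (0 : ℝ) ≤ d := by positivity
  -- Inaccurate outputs contribute at least zero. Dropping them loses at most one third of the
  -- largest possible gain `3/16 * d`, which is the term `d / 3`.
  have lower : ∀ X : Fin d → Finset (Fin n),
      (n / (n + 1) : ℝ) * (3 / 16 * (heavyCount X - d / 3) - d / 256)
        ≤ ∑ i, ∫ y, max (traceScore i X (f y)) 0 ∂(μ X) := by
    intro X
    set Bad : Set Y := {y | ∃ j, 1 / 8 < |f y j - (2 * (X j).card - n : ℝ) / n|} with hBad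
    have hBadm : MeasurableSet Bad := by
      rw [hBad, Set.ofPred_exists]
      exact MeasurableSet.iUnion fun j => measurableSet_lt measurable_const
        ((((measurable_pi_apply j).comp hf).sub_const _).abs)
    set κ : ℝ := 3 / 16 * heavyCount X - d / 256
    set ρ : ℝ := n / (n + 1)
    have hρ : 0 ≤ ρ := by positivity
    have hh : (heavyCount X : ℝ) ≤ d := by
      have : heavyCount X ≤ d := by
        simpa [heavyCount] using Finset.card_le_univ
          (Finset.univ.filter fun j => 4 * (X j).card ≤ n ∨ 3 * n ≤ 4 * (X j).card)
      exact_mod_cast this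
    have hint : Integrable (Badᶜ.indicator fun _ => ρ * κ) (μ X) :=
      (integrable_const _).indicator hBadm.compl
    rw [← integral_finsetSum _ fun i _ => integrable_max_traceScore hf hf1 i X (μ X)]
    have hle : ∫ y, Badᶜ.indicator (fun _ => ρ * κ) y ∂(μ X)
        ≤ ∫ y, ∑ i, max (traceScore i X (f y)) 0 ∂(μ X) := by
      refine integral_mono hint
        (integrable_finsetSum _ fun i _ => integrable_max_traceScore hf hf1 i X (μ X)) fun y => ?_
      by_cases hy : y ∈ Bad
      · rw [Set.indicator_of_notMem (by simpa using hy)]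
        exact Finset.sum_nonneg fun i _ => le_max_right _ _
      · rw [Set.indicator_of_mem (by simpa using hy)]
        refine (sum_traceScore_ge hn X fun j => ?_).trans
          (Finset.sum_le_sum fun i _ => le_max_left _ _)
        by_contra hj
        exact hy ⟨j, not_le.1 hj⟩
    refine le_trans ?_ hle
    rw [integral_indicator_const _ hBadm.compl, probReal_compl_eq_one_sub hBadm, smul_eq_mul]
    have hb := hacc X
    have hb0 : 0 ≤ (μ X).real Bad := measureReal_nonneg
    have : 3 / 16 * (heavyCount X - d / 3 : ℝ) - d / 256 ≤ (1 - (μ X).real Bad) * κ := by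
      have hx : (μ X).real Bad * κ ≤ 1 / 3 * (3 / 16 * d) := by
        calc (μ X).real Bad * κ ≤ (μ X).real Bad * (3 / 16 * d) := by
              gcongr
              simp only [κ]
              linarith
          _ ≤ 1 / 3 * (3 / 16 * d) := by gcongr
      have e : (1 - (μ X).real Bad) * κ = 3 / 16 * heavyCount X - d / 256 - (μ X).real Bad * κ := by
        simp only [κ]; ring
      rw [e]
      linarith
    calc ρ * _ ≤ ρ * ((1 - (μ X).real Bad) * κ) := mul_le_mul_of_nonneg_left this hρ
      _ = _ := by ring
  have hheavy := half_mul_le_sum_heavyCount (n := n) (d := d)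
  have hρ : (1 / 2 : ℝ) ≤ n / (n + 1) := by
    rw [le_div_iff₀ (by positivity)]
    linarith
  -- On average at least half of the columns are heavy, and `3/16 * (1/2 - 1/3) - 1/256 = 7/256`.
  calc 7 / 512 * (d : ℝ) = 1 / 2 * (7 / 256 * d) := by ring
    _ ≤ (n / (n + 1) : ℝ) * (7 / 256 * d) := by gcongr
    _ ≤ (n / (n + 1) : ℝ) * (3 / 16 * ((∑ X : Fin d → Finset (Fin n),
          (∏ j, urnWeight (X j)) * heavyCount X) - d / 3) - d / 256) := by
        gcongr
        linarith
    _ = ∑ X : Fin d → Finset (Fin n), (∏ j, urnWeight (X j)) *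
          ((n / (n + 1) : ℝ) * (3 / 16 * (heavyCount X - d / 3) - d / 256)) := by
        have e : ∀ X : Fin d → Finset (Fin n), (∏ j, urnWeight (X j)) *
            ((n / (n + 1) : ℝ) * (3 / 16 * (heavyCount X - d / 3) - d / 256))
            = (n / (n + 1) : ℝ) * (3 / 16) * ((∏ j, urnWeight (X j)) * heavyCount X)
              - (∏ j, urnWeight (X j)) * ((n / (n + 1) : ℝ) * (d / 16 + d / 256)) := fun X => by
          ring
        simp_rw [e]
        rw [Finset.sum_sub_distrib, ← Finset.mul_sum, ← Finset.sum_mul, hW1]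
        ring
    _ ≤ ∑ X : Fin d → Finset (Fin n), (∏ j, urnWeight (X j)) *
          ∑ i, ∫ y, max (traceScore i X (f y)) 0 ∂(μ X) :=
        Finset.sum_le_sum fun X _ => mul_le_mul_of_nonneg_left (lower X) (hW X)
    _ = ∑ i, ∑ X : Fin d → Finset (Fin n), (∏ j, urnWeight (X j)) *
          ∫ y, max (traceScore i X (f y)) 0 ∂(μ X) := by
        rw [Finset.sum_comm]
        exact Finset.sum_congr rfl fun X _ => Finset.mul_sum _ _ _
    _ ≤ ∑ _i : Fin n, (C * r + d * δ) := Finset.sum_le_sum fun i _ =>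
        sum_urnWeight_mul_integral_traceScore_le hr hd hC μ hf hf1 i (hDP i)
    _ = n * (C * r + d * δ) := by simp; ring

end Fingerprint

/-! ### Phased edge streams and group privacy. -/

section Stream

variable {V : Type*} {T L : ℕ}

/-- The indices of the edges present after `t` updates, if in phase `j` (of length `2 * L`) the
edges with index in `B j` are inserted one after another and then deleted in the same order. -/
def activeEdges (B : ℕ → Finset (Fin L)) (t : ℕ) : Set (Fin L) :=
  {r | r ∈ B (t / (2 * L)) ∧ (r : ℕ) < t % (2 * L) ∧ t % (2 * L) ≤ L + r}

lemma activeEdges_zero (B : ℕ → Finset (Fin L)) : activeEdges B 0 = ∅ := by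
  ext r
  simp [activeEdges]

lemma activeEdges_query (B : ℕ → Finset (Fin L)) (j : ℕ) :
    activeEdges B (2 * L * j + L) = B j := by
  ext r
  have hr := r.isLt
  have h1 : (2 * L * j + L) / (2 * L) = j := by
    rw [Nat.mul_add_div (by omega), Nat.div_eq_of_lt (by omega), add_zero]
  have h2 : (2 * L * j + L) % (2 * L) = L := by
    rw [Nat.mul_add_mod, Nat.mod_eq_of_lt (by omega)]
  simp [activeEdges, h1, h2]

/-- At offset `u` in a phase, only index `u` can enter and only index `u - L` can leave. When a
phase ends, only the last index `L - 1` can still be active, and it leaves as the offset wraps to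
zero. -/
lemma encard_symmDiff_activeEdges_le (B : ℕ → Finset (Fin L)) (t : ℕ) :
    (symmDiff (activeEdges B t) (activeEdges B (t + 1))).encard ≤ 1 := by
  rw [Set.encard_le_one_iff]
  intro r r' hr hr'
  have hL : 0 < 2 * L := by have := r.isLt; omega
  have hr1 := r.isLt
  have hr1' := r'.isLt
  rw [Fin.ext_iff]
  simp only [Set.mem_symmDiff, activeEdges, Set.mem_ofPred_eq] at hr hr'
  have hu := Nat.mod_lt t hL
  by_cases hlt : t % (2 * L) + 1 < 2 * L
  · have h1 : (t + 1) % (2 * L) = t % (2 * L) + 1 := by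
      rw [Nat.add_mod, Nat.mod_eq_of_lt (a := 1) (by omega), Nat.mod_eq_of_lt hlt]
    have h2 : (t + 1) / (2 * L) = t / (2 * L) := by
      rw [Nat.add_div hL, Nat.mod_eq_of_lt (a := 1) (by omega), Nat.div_eq_of_lt (a := 1) (by omega)]
      simp; omega
    rw [h1, h2] at hr hr'
    by_cases hb : r ∈ B (t / (2 * L)) <;> by_cases hb' : r' ∈ B (t / (2 * L)) <;>
      simp only [hb, hb', true_and, false_and, not_false_eq_true, or_self] at hr hr' <;> omega
  · have h0 : t % (2 * L) = 2 * L - 1 := by omega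
    have h1 : (t + 1) % (2 * L) = 0 := by
      rw [Nat.add_mod, h0]
      rcases Nat.lt_or_ge 1 (2 * L) with h | h
      · rw [Nat.mod_eq_of_lt h, Nat.sub_add_cancel h.le, Nat.mod_self]
      · omega
    rw [h1, h0] at hr hr'
    omega

variable (E : Fin L → Sym2 V)

/-- The graph with the edges `E r` for `r` in a set of indices. -/
def edgeGraph (s : Set (Fin L)) : SimpleGraph V := SimpleGraph.fromEdgeSet (E '' s)

variable {E}

lemma edgeSet_edgeGraph (hE : ∀ r, ¬ (E r).IsDiag) (s : Set (Fin L)) :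
    (edgeGraph E s).edgeSet = E '' s := by
  rw [edgeGraph, SimpleGraph.edgeSet_fromEdgeSet, sdiff_eq_left, Set.disjoint_left]
  rintro _ ⟨r, _, rfl⟩ h
  exact hE r h

/-- The dynamic graph sequence that inserts and deletes edges as in `activeEdges`. -/
def streamSeq (T : ℕ) (hE : ∀ r, ¬ (E r).IsDiag) (B : ℕ → Finset (Fin L)) : DynGraphSeq V T where
  graph t := edgeGraph E (activeEdges B t)
  graph_zero := by
    simp [activeEdges_zero, edgeGraph]
  step t := by
    simp only [edgeSet_edgeGraph hE, Fin.val_castSucc, Fin.val_succ]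
    refine le_trans ?_ (encard_symmDiff_activeEdges_le B t)
    refine le_trans (Set.encard_le_encard ?_) (Set.encard_image_le E _)
    rintro e (⟨⟨r, hr, rfl⟩, h⟩ | ⟨⟨r, hr, rfl⟩, h⟩)
    · exact ⟨r, Or.inl ⟨hr, fun h' => h ⟨r, h', rfl⟩⟩, rfl⟩
    · exact ⟨r, Or.inr ⟨hr, fun h' => h ⟨r, h', rfl⟩⟩, rfl⟩

/-- Each edge has its own time slots in every phase, left idle if the edge is not used. Changing one
edge in all phases therefore does not shift the updates of the others. -/
lemma itemNeighboring_streamSeq (hE : ∀ r, ¬ (E r).IsDiag) {B B' : ℕ → Finset (Fin L)}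
    (r₀ : Fin L) (h : ∀ j r, r ≠ r₀ → (r ∈ B j ↔ r ∈ B' j)) :
    (streamSeq T hE B).ItemNeighboring (streamSeq T hE B') := by
  have key : ∀ (t : ℕ) (e : Sym2 V), e ≠ E r₀ →
      (e ∈ E '' activeEdges B t ↔ e ∈ E '' activeEdges B' t) := by
    intro t e he
    simp only [Set.mem_image]
    refine exists_congr fun r => and_congr_left fun hr => ?_
    have hne : r ≠ r₀ := by rintro rfl; exact he hr.symm
    simp only [activeEdges, Set.mem_ofPred_eq, h _ r hne]
  refine ⟨E r₀, fun t => ⟨?_, ?_⟩⟩ <;> ext e <;>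
    simp only [DynGraphSeq.inserted, DynGraphSeq.deleted, streamSeq, edgeSet_edgeGraph hE,
      Set.mem_sdiff, Set.mem_singleton_iff] <;>
    refine and_congr_left fun he => ?_ <;>
    rw [key _ e he, key _ e he]

variable {k : ℕ}

/-- Group privacy for the edges with index in `R`. -/
lemma groupPrivacy {A : ContinualAlg V T k} {ε δ : ℝ} (hε : 0 ≤ ε) (hδ : 0 ≤ δ)
    (hA : A.ItemLevelDP ε δ) (hE : ∀ r, ¬ (E r).IsDiag) (R : Finset (Fin L))
    (B B' : ℕ → Finset (Fin L)) (h : ∀ j, ∀ r ∉ R, (r ∈ B j ↔ r ∈ B' j))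
    {O : Set (Fin T → Fin k → ℝ)} (hO : MeasurableSet O) :
    (A.law (streamSeq T hE B)).real O ≤
      Real.exp (R.card * ε) * (A.law (streamSeq T hE B')).real O
        + R.card * Real.exp (R.card * ε) * δ := by
  classical
  induction R using Finset.induction_on generalizing B with
  | empty =>
    have : B = B' := by
      funext j; ext r; exact h j r (by simp)
    simp [this]
  | insert r₀ R hr₀ ih =>
    -- Hybrid stream: it follows `B'` on `r₀` and `B` elsewhere, so it neighbours `B` and differs
    -- from `B'` only inside `R`.
    set B'' : ℕ → Finset (Fin L) := fun j => setMem r₀ (decide (r₀ ∈ B' j)) (B j)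
    have hne : ∀ j r, r ≠ r₀ → (r ∈ B'' j ↔ r ∈ B j) := fun j r hr => by
      simp only [B'', setMem]
      split_ifs <;> simp [hr]
    have h1 := hA _ _ (itemNeighboring_streamSeq (T := T) hE r₀
      fun j r hr => (hne j r hr).symm) O hO
    have h2 := ih B'' fun j r hr => by
      by_cases hrr : r = r₀
      · subst hrr
        simp [B'', mem_setMem]
      · rw [hne j r hrr]
        exact h j r (by simp [hrr, hr])
    rw [Finset.card_insert_of_notMem hr₀]
    push_cast
    have e : Real.exp ((R.card + 1) * ε) = Real.exp ε * Real.exp (R.card * ε) := by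
      rw [← Real.exp_add]; ring_nf
    have e1 : 1 ≤ Real.exp ((R.card + 1) * ε) := Real.one_le_exp (by positivity)
    calc _ ≤ Real.exp ε * (Real.exp (R.card * ε) * (A.law (streamSeq T hE B')).real O
        + R.card * Real.exp (R.card * ε) * δ) + 1 * δ := by
          refine h1.trans ?_
          rw [one_mul]
          gcongr
      _ ≤ Real.exp ε * (Real.exp (R.card * ε) * (A.law (streamSeq T hE B')).real O
        + R.card * Real.exp (R.card * ε) * δ) + Real.exp ((R.card + 1) * ε) * δ := by gcongr
      _ = _ := by rw [e]; ring

end Stream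

/-! ### Disjoint stars and their graph parameters. -/

section Stars

variable {V : Type*} {M g : ℕ}

/-- The `l`-th edge of the `σ`-th star, for a placement `ν` of `M` disjoint stars with `g` leaves;
`ν (σ, 0)` is the centre of the `σ`-th star. -/
def starEdge (ν : Fin M × Fin (g + 1) ↪ V) (q : Fin M × Fin g) : Sym2 V :=
  s(ν (q.1, 0), ν (q.1, q.2.succ))

/-- The disjoint union of the stars with index in `X`. -/
def starGraph (ν : Fin M × Fin (g + 1) ↪ V) (X : Finset (Fin M)) : SimpleGraph V :=
  SimpleGraph.fromEdgeSet {e | ∃ σ ∈ X, ∃ l : Fin g, starEdge ν (σ, l) = e}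

variable (ν : Fin M × Fin (g + 1) ↪ V)

lemma starEdge_not_isDiag (q : Fin M × Fin g) : ¬ (starEdge ν q).IsDiag := by
  rw [starEdge, Sym2.mk_isDiag_iff, ν.injective.eq_iff, Prod.mk.injEq]
  exact fun h => (Fin.succ_ne_zero _ h.2.symm)

lemma starGraph_adj {X : Finset (Fin M)} {u v : V} : (starGraph ν X).Adj u v ↔
    ∃ σ ∈ X, ∃ l : Fin g, (u = ν (σ, 0) ∧ v = ν (σ, l.succ)) ∨
      (u = ν (σ, l.succ) ∧ v = ν (σ, 0)) := by
  rw [starGraph, SimpleGraph.fromEdgeSet_adj]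
  constructor
  · rintro ⟨⟨σ, hσ, l, h⟩, _⟩
    rw [starEdge, eq_comm, Sym2.eq_iff] at h
    exact ⟨σ, hσ, l, h⟩
  · rintro ⟨σ, hσ, l, h⟩
    refine ⟨⟨σ, hσ, l, ?_⟩, ?_⟩
    · rw [starEdge, eq_comm, Sym2.eq_iff]
      exact h
    · have hne : ν (σ, 0) ≠ ν (σ, l.succ) := fun e =>
        Fin.succ_ne_zero l (congrArg Prod.snd (ν.injective e)).symm
      rcases h with ⟨rfl, rfl⟩ | ⟨rfl, rfl⟩
      · exact hne
      · exact hne.symm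

lemma starGraph_adj_center {X : Finset (Fin M)} {σ : Fin M} {v : V} :
    (starGraph ν X).Adj (ν (σ, 0)) v ↔ σ ∈ X ∧ ∃ l : Fin g, v = ν (σ, l.succ) := by
  rw [starGraph_adj]
  constructor
  · rintro ⟨σ', hσ', l, ⟨h, rfl⟩ | ⟨h, _⟩⟩ <;>
      rw [ν.injective.eq_iff, Prod.mk.injEq] at h
    · obtain ⟨rfl, _⟩ := h
      exact ⟨hσ', l, rfl⟩
    · exact absurd h.2.symm (Fin.succ_ne_zero l)
  · rintro ⟨hσ, l, rfl⟩
    exact ⟨σ, hσ, l, Or.inl ⟨rfl, rfl⟩⟩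

lemma starGraph_adj_leaf {X : Finset (Fin M)} {σ : Fin M} {l : Fin g} {v : V} :
    (starGraph ν X).Adj (ν (σ, l.succ)) v ↔ σ ∈ X ∧ v = ν (σ, 0) := by
  rw [starGraph_adj]
  constructor
  · rintro ⟨σ', hσ', l', ⟨h, _⟩ | ⟨h, rfl⟩⟩ <;>
      rw [ν.injective.eq_iff, Prod.mk.injEq] at h
    · exact absurd h.2 (Fin.succ_ne_zero l)
    · obtain ⟨rfl, _⟩ := h
      exact ⟨hσ', rfl⟩
  · rintro ⟨hσ, rfl⟩
    exact ⟨σ, hσ, l, Or.inr ⟨rfl, rfl⟩⟩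

lemma edgeGraph_starEdge (X : Finset (Fin M)) :
    edgeGraph (fun r : Fin (M * g) => starEdge ν (finProdFinEquiv.symm r))
      ↑((X ×ˢ (Finset.univ : Finset (Fin g))).map finProdFinEquiv.toEmbedding) = starGraph ν X := by
  unfold edgeGraph starGraph
  congr 1
  ext e
  simp only [Set.mem_image, Finset.mem_coe, Finset.mem_map, Finset.mem_product, Finset.mem_univ,
    and_true, Equiv.coe_toEmbedding, Prod.exists, Set.mem_ofPred_eq]
  constructor
  · rintro ⟨_, ⟨σ, l, hσ, rfl⟩, h⟩
    rw [Equiv.symm_apply_apply] at h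
    exact ⟨σ, hσ, l, h⟩
  · rintro ⟨σ, hσ, l, h⟩
    exact ⟨_, ⟨σ, l, hσ, rfl⟩, by rw [Equiv.symm_apply_apply]; exact h⟩

/-- With one leaf per star the whole edge set is a matching, hence the largest one. -/
lemma maxMatchingSize_starGraph [Finite V] (ν : Fin M × Fin (1 + 1) ↪ V) (X : Finset (Fin M)) :
    maxMatchingSize (starGraph ν X) = X.card := by
  set H := starGraph ν X
  have hE : H.edgeSet = (fun σ => starEdge ν (σ, 0)) '' X := by
    rw [show H = SimpleGraph.fromEdgeSet _ from rfl, SimpleGraph.edgeSet_fromEdgeSet]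
    ext e
    simp only [Set.mem_sdiff, Set.mem_ofPred_eq, Set.mem_image, Finset.mem_coe]
    constructor
    · rintro ⟨⟨σ, hσ, l, h⟩, _⟩
      exact ⟨σ, hσ, by rw [← h, Subsingleton.elim l 0]⟩
    · rintro ⟨σ, hσ, rfl⟩
      exact ⟨⟨σ, hσ, 0, rfl⟩, starEdge_not_isDiag ν _⟩
  have hinj : Function.Injective fun σ => starEdge ν (σ, (0 : Fin 1)) := by
    intro σ σ' h
    simp only [starEdge, Sym2.eq_iff, ν.injective.eq_iff, Prod.mk.injEq] at h
    rcases h with h | h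
    · exact h.1.1
    · exact h.1.1
  have hcard : H.edgeSet.ncard = X.card := by
    rw [hE, Set.ncard_image_of_injective _ hinj, Set.ncard_coe_finset]
  refine IsGreatest.csSup_eq ⟨?_, ?_⟩
  · refine ⟨{ verts := H.support
              Adj := H.Adj
              adj_sub := id
              edge_vert := fun h => ⟨_, h⟩
              symm := ⟨fun _ _ h => h.symm⟩ }, ?_, ?_⟩
    · rintro v ⟨w, hw⟩
      refine ⟨w, hw, fun w' (hw' : H.Adj v w') => ?_⟩
      obtain ⟨σ, hσ, l, ⟨rfl, rfl⟩ | ⟨rfl, rfl⟩⟩ := (starGraph_adj ν).1 hw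
      · obtain ⟨_, l', rfl⟩ := (starGraph_adj_center ν).1 hw'
        rw [Subsingleton.elim l l']
      · exact ((starGraph_adj_leaf ν).1 hw').2
    · rw [← hcard]
      congr 1
  · rintro m ⟨S, _, rfl⟩
    rw [← hcard]
    exact Set.ncard_le_ncard S.edgeSet_subset (Set.toFinite _)

-- Every leaf of a present star is absorbed by its centre, so the remaining vertices represent each
-- component once. The map `root` is constant on components and separates them.
open Classical in
lemma numComponents_starGraph [Fintype V] (X : Finset (Fin M)) :
    numComponents (starGraph ν X) + X.card * g = Fintype.card V := by
  set H := starGraph ν X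
  set leaves : Finset V := (X ×ˢ (Finset.univ : Finset (Fin g))).image
    fun q => ν (q.1, q.2.succ) with hleaves
  have mem_leaves : ∀ v, v ∈ leaves ↔ ∃ σ ∈ X, ∃ l : Fin g, ν (σ, l.succ) = v := fun v => by
    simp [hleaves]
  have hcard : leaves.card = X.card * g := by
    rw [hleaves, Finset.card_image_of_injective, Finset.card_product, Finset.card_univ,
      Fintype.card_fin]
    intro q q' h
    have := ν.injective h
    rw [Prod.mk.injEq, Fin.succ_inj] at this
    exact Prod.ext this.1 this.2
  set root : V → V := fun v => if h : v ∈ leaves then ν (((mem_leaves v).1 h).choose, 0) else v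
  have center_notMem : ∀ σ : Fin M, ν (σ, 0) ∉ leaves := by
    intro σ h
    obtain ⟨σ', _, l, h⟩ := (mem_leaves _).1 h
    exact Fin.succ_ne_zero l (congrArg Prod.snd (ν.injective h))
  have root_leaf : ∀ σ ∈ X, ∀ l : Fin g, root (ν (σ, l.succ)) = ν (σ, 0) := by
    intro σ hσ l
    have h : ν (σ, l.succ) ∈ leaves := (mem_leaves _).2 ⟨σ, hσ, l, rfl⟩
    have hs := ((mem_leaves _).1 h).choose_spec.2
    simp only [root, dif_pos h]
    obtain ⟨l', hl'⟩ := hs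
    exact congrArg (fun q : Fin M × Fin (g + 1) => ν (q.1, 0)) (ν.injective hl')
  have root_other : ∀ v ∉ leaves, root v = v := fun v h => by simp only [root, dif_neg h]
  have root_adj : ∀ u v, H.Adj u v → root u = root v := by
    intro u v h
    obtain ⟨σ, hσ, l, ⟨rfl, rfl⟩ | ⟨rfl, rfl⟩⟩ := (starGraph_adj ν).1 h <;>
      rw [root_leaf σ hσ, root_other _ (center_notMem σ)]
  have root_reach : ∀ u v, H.Reachable u v → root u = root v := by
    rintro u v ⟨p⟩
    induction p with
    | nil => rfl
    | cons h _ ih => exact (root_adj _ _ h).trans ih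
  have bij : Function.Bijective
      (fun v : {v // v ∉ leaves} => H.connectedComponentMk v) := by
    constructor
    · rintro ⟨u, hu⟩ ⟨v, hv⟩ h
      have := root_reach u v (SimpleGraph.ConnectedComponent.eq.1 h)
      rw [root_other u hu, root_other v hv] at this
      exact Subtype.ext this
    · intro c
      induction c using SimpleGraph.ConnectedComponent.ind with | _ v => ?_
      by_cases h : v ∈ leaves
      · obtain ⟨σ, hσ, l, rfl⟩ := (mem_leaves _).1 h
        refine ⟨⟨ν (σ, 0), center_notMem σ⟩, ?_⟩
        exact SimpleGraph.ConnectedComponent.eq.2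
          ((starGraph_adj_center ν).2 ⟨hσ, l, rfl⟩).reachable
      · exact ⟨⟨v, h⟩, rfl⟩
  rw [numComponents, ← Nat.card_eq_of_bijective _ bij, Nat.card_eq_fintype_card,
    Fintype.card_subtype_compl, ← hcard, Fintype.card_coe]
  exact Nat.sub_add_cancel (Finset.card_le_univ _)

lemma degree_eq_ncard (G : SimpleGraph V) (v : V) [Fintype (G.neighborSet v)] :
    G.degree v = (G.neighborSet v).ncard := by
  rw [Set.ncard_eq_toFinset_card', ← SimpleGraph.card_neighborFinset_eq_degree]
  rfl

open Classical in
/-- Counting nodes by their degree, for a property that fails for degree zero. -/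
lemma card_filter_degree_starGraph [Fintype V] (X : Finset (Fin M)) (P : ℕ → Prop) (hP : ¬ P 0) :
    (Finset.univ.filter fun v : V => P ((starGraph ν X).degree v)).card
      = X.card * (Finset.univ.filter fun p : Fin (g + 1) => P (if p = 0 then g else 1)).card := by
  have hdeg : ∀ σ ∈ X, ∀ p : Fin (g + 1),
      (starGraph ν X).degree (ν (σ, p)) = if p = 0 then g else 1 := by
    intro σ hσ p
    rw [degree_eq_ncard]
    refine Fin.cases ?_ (fun l => ?_) p
    · have : (starGraph ν X).neighborSet (ν (σ, 0)) = Set.range fun l : Fin g => ν (σ, l.succ) := by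
        ext v
        rw [SimpleGraph.mem_neighborSet, starGraph_adj_center]
        simp [hσ, eq_comm]
      rw [this, ← Set.image_univ, Set.ncard_image_of_injective, Set.ncard_univ]
      · simp
      · intro l l' h
        have := ν.injective h
        rw [Prod.mk.injEq, Fin.succ_inj] at this
        exact this.2
    · have : (starGraph ν X).neighborSet (ν (σ, l.succ)) = {ν (σ, 0)} := by
        ext v
        rw [SimpleGraph.mem_neighborSet, starGraph_adj_leaf]
        simp [hσ]
      rw [this, Set.ncard_singleton, if_neg (Fin.succ_ne_zero l)]
  have hzero : ∀ v, (∀ σ ∈ X, ∀ p, ν (σ, p) ≠ v) → (starGraph ν X).degree v = 0 := by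
    intro v hv
    rw [degree_eq_ncard]
    have : (starGraph ν X).neighborSet v = ∅ := by
      ext w
      rw [SimpleGraph.mem_neighborSet, starGraph_adj]
      simp only [Set.mem_empty_iff_false, iff_false]
      rintro ⟨σ, hσ, l, ⟨h, _⟩ | ⟨h, _⟩⟩
      · exact hv σ hσ _ h.symm
      · exact hv σ hσ _ h.symm
    rw [this, Set.ncard_empty]
  rw [← Finset.card_product, ← Finset.card_map ν]
  congr 1
  ext v
  simp only [Finset.mem_filter, Finset.mem_univ, true_and, Finset.mem_map, Finset.mem_product,
    Prod.exists]
  constructor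
  · intro h
    by_cases hv : ∀ σ ∈ X, ∀ p, ν (σ, p) ≠ v
    · rw [hzero v hv] at h
      exact absurd h hP
    · push Not at hv
      obtain ⟨σ, hσ, p, rfl⟩ := hv
      rw [hdeg σ hσ] at h
      exact ⟨σ, p, ⟨hσ, h⟩, rfl⟩
  · rintro ⟨σ, p, ⟨hσ, h⟩, rfl⟩
    rw [hdeg σ hσ]
    exact h

end Stars

/-! ### From graph problems to private counting queries. -/

namespace GraphProblem

/-- The number of leaves of the stars used for a problem. -/
def leafCount : GraphProblem → ℕ
  | highDegree τ => τ
  | _ => 1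

lemma leafCount_pos (p : GraphProblem) : 0 < p.leafCount := by
  cases p <;> simp [leafCount]

/-- Some coordinate of the value is affine in the number of stars. -/
lemma exists_value_starGraph_eq (p : GraphProblem) {N : ℕ} (hN : 2 ≤ N) :
    ∃ (j₀ : Fin (p.dim N)) (a b : ℝ), 1 ≤ |b| ∧
      ∀ {M : ℕ} (ν : Fin M × Fin (p.leafCount + 1) ↪ Fin N) (X : Finset (Fin M)),
        p.value N (starGraph ν X) j₀ = a + b * X.card := by
  cases p with
  | maximumMatching =>
    refine ⟨(0 : Fin 1), 0, 1, by simp, fun {M} ν X => ?_⟩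
    have h : (maxMatchingSize (starGraph ν X) : ℝ) = X.card :=
      congrArg Nat.cast (maxMatchingSize_starGraph ν X)
    exact h.trans (by ring)
  | connectedComponents =>
    refine ⟨(0 : Fin 1), N, -1, by simp, fun {M} ν X => ?_⟩
    have h : ((numComponents (starGraph ν X) + X.card * 1 : ℕ) : ℝ) = N :=
      congrArg Nat.cast ((numComponents_starGraph ν X).trans (Fintype.card_fin N))
    push_cast at h
    change (numComponents (starGraph ν X) : ℝ) = _
    linarith
  | highDegree τ =>
    -- The centre always counts; for `τ = 1` the leaf does too, so `b` is 1 or 2. Only `1 ≤ b` is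
    -- needed.
    set b := (Finset.univ.filter fun p : Fin ((τ : ℕ) + 1) =>
      (τ : ℕ) ≤ if p = 0 then (τ : ℕ) else 1).card
    have hb : 1 ≤ b := Finset.card_pos.2 ⟨0, by simp⟩
    refine ⟨(0 : Fin 1), 0, b, ?_, fun {M} ν X => ?_⟩
    · rw [Nat.abs_cast]
      exact_mod_cast hb
    · have h : numHighDegree τ (starGraph ν X) = X.card * b := by
        simp only [numHighDegree, b]
        convert card_filter_degree_starGraph (g := τ) ν X (fun m => (τ : ℕ) ≤ m) (by simp)
        rfl
      change (numHighDegree τ (starGraph ν X) : ℝ) = _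
      rw [h]
      push_cast
      ring
  | degreeHistogram =>
    refine ⟨(⟨1, hN⟩ : Fin N), 0, 2, by norm_num, fun {M} ν X => ?_⟩
    have e : (Finset.univ.filter fun p : Fin (1 + 1) => (if p = 0 then 1 else 1) = 1).card = 2 := by
      decide
    have h : numOfDegree 1 (starGraph ν X) = X.card * 2 := by
      rw [← e]
      unfold numOfDegree
      convert card_filter_degree_starGraph (g := 1) ν X (fun m => m = 1) (by simp)
      rfl
    change (numOfDegree 1 (starGraph ν X) : ℝ) = _
    rw [h]
    push_cast
    ring

end GraphProblem

lemma measurableSet_exists_error {Y : Type*} [MeasurableSpace Y] {d : ℕ} {f : Y → Fin d → ℝ}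
    (hf : Measurable f) (c : Fin d → ℝ) (α : ℝ) : MeasurableSet {y | ∃ j, α < |f y j - c j|} := by
  rw [Set.ofPred_exists]
  exact MeasurableSet.iUnion fun j => measurableSet_lt measurable_const
    ((((measurable_pi_apply j).comp hf).sub_const _).abs)

/-- A continual release algorithm for one of the graph problems answers counting queries on
`M` records, privately for groups of records. -/
theorem exists_countingMechanism (p : GraphProblem) {N T M d : ℕ} {ε δ α : ℝ} (hε : 0 ≤ ε)
    (hδ : 0 ≤ δ) (hN : 2 ≤ N) (hM : 0 < M) (hMN : M * (p.leafCount + 1) ≤ N)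
    (hT : 2 * (M * p.leafCount) * d ≤ T) (A : ContinualAlg (Fin N) T (p.dim N))
    (hA : A.ItemLevelDP ε δ) (hacc : ∀ S, A.AccurateOn (p.value N) α (1 / 3) S) :
    ∃ μ : (Fin d → Finset (Fin M)) → Measure (Fin d → ℝ),
      (∀ X, IsProbabilityMeasure (μ X)) ∧
      (∀ (R : Finset (Fin M)) (X X' : Fin d → Finset (Fin M)),
        (∀ j, ∀ σ ∉ R, (σ ∈ X j ↔ σ ∈ X' j)) → ∀ O, MeasurableSet O →
          (μ X).real O ≤ Real.exp (R.card * p.leafCount * ε) * (μ X').real O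
            + R.card * p.leafCount * Real.exp (R.card * p.leafCount * ε) * δ) ∧
      ∀ X, (μ X).real {y | ∃ j, α < |y j - (X j).card|} ≤ 1 / 3 := by
  obtain ⟨j₀, a, b, hb, hval⟩ := p.exists_value_starGraph_eq hN
  set g := p.leafCount
  have hg : 0 < g := p.leafCount_pos
  set L := M * g
  have hL : 0 < L := Nat.mul_pos hM hg
  set ν : Fin M × Fin (g + 1) ↪ Fin N :=
    finProdFinEquiv.toEmbedding.trans (Fin.castLEEmb hMN)
  set E : Fin L → Sym2 (Fin N) := fun r => starEdge ν (finProdFinEquiv.symm r)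
  have hE : ∀ r, ¬ (E r).IsDiag := fun r => starEdge_not_isDiag ν _
  set block : Finset (Fin M) → Finset (Fin L) := fun x =>
    (x ×ˢ (Finset.univ : Finset (Fin g))).map finProdFinEquiv.toEmbedding with hblock
  have mem_block : ∀ x r, r ∈ block x ↔ (finProdFinEquiv.symm r).1 ∈ x := fun x r => by
    simp only [hblock, Finset.mem_map_equiv, Finset.mem_product, Finset.mem_univ, and_true]
  have card_block : ∀ x, (block x).card = x.card * g := fun x => by simp [hblock]
  -- After the `d` phases the graph stays empty for the remaining time.
  set B : (Fin d → Finset (Fin M)) → ℕ → Finset (Fin L) := fun X j =>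
    if h : j < d then block (X ⟨j, h⟩) else ∅ with hB
  have hq : ∀ j : Fin d, 2 * L * j + L - 1 < T := by
    intro j
    have h1 : 2 * L * (j + 1) ≤ 2 * L * d := Nat.mul_le_mul_left _ j.isLt
    have h2 : 2 * L * (j + 1 : ℕ) = 2 * L * j + L + L := by ring
    omega
  -- An index `t : Fin T` stands for time `t + 1`, so the midpoint `2 * L * j + L` has index one
  -- less.
  set q : Fin d → Fin T := fun j => ⟨2 * L * j + L - 1, hq j⟩
  have hgraph : ∀ X j, (streamSeq T hE (B X)).graph (q j).succ = starGraph ν (X j) := by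
    intro X j
    have h : ((q j).succ : ℕ) = 2 * L * j + L := by
      simp only [q, Fin.val_succ]
      omega
    change edgeGraph E (activeEdges (B X) ((q j).succ : ℕ)) = _
    rw [h, activeEdges_query]
    simp only [hB, j.isLt, dif_pos]
    exact edgeGraph_starEdge ν (X j)
  set out : (Fin T → Fin (p.dim N) → ℝ) → Fin d → ℝ := fun w j => (w (q j) j₀ - a) / b
  have hout : Measurable out := by
    refine measurable_pi_lambda _ fun j => ?_
    have h : Measurable fun w : Fin T → Fin (p.dim N) → ℝ => w (q j) j₀ :=
      (measurable_pi_apply j₀).comp (measurable_pi_apply (q j))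
    exact (h.sub_const a).div_const b
  have hb0 : b ≠ 0 := by
    rintro rfl
    norm_num at hb
  have hprob : ∀ S, IsProbabilityMeasure (A.law S) := A.prob
  refine ⟨fun X => (A.law (streamSeq T hE (B X))).map out, fun X =>
    Measure.isProbabilityMeasure_map hout.aemeasurable, fun R X X' hXX' O hO => ?_, fun X => ?_⟩
  · rw [map_measureReal_apply hout hO, map_measureReal_apply hout hO]
    have h := groupPrivacy hε hδ hA hE (block R) (B X) (B X') (fun j r hr => by
      simp only [hB]
      split_ifs with hj
      · rw [mem_block, mem_block]
        exact hXX' _ _ (by rwa [mem_block] at hr)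
      · rfl) (hout hO)
    rw [card_block] at h
    push_cast at h
    exact h
  · have hmeas : MeasurableSet {y : Fin d → ℝ | ∃ j, α < |y j - (X j).card|} :=
      measurableSet_exists_error measurable_id _ _
    rw [map_measureReal_apply hout hmeas]
    refine (measureReal_mono ?_).trans (hacc (streamSeq T hE (B X)))
    rintro w ⟨j, hj⟩
    refine ⟨q j, hj.trans_le ?_⟩
    rw [hgraph]
    refine le_trans ?_ (norm_le_pi_norm _ j₀)
    rw [Pi.sub_apply, hval, Real.norm_eq_abs]
    -- Since `|b| ≥ 1`, inverting the affine map does not enlarge the error.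
    have e : w (q j) j₀ - (a + b * (X j).card) = b * (out w j - (X j).card) := by
      simp only [out]
      field_simp
      ring
    rw [e, abs_mul]
    exact le_mul_of_one_le_left (abs_nonneg _) hb

/-! ### Lower bounds on the error for given parameters. -/

/-- The error of an approximately private algorithm, for `n` records with `k` copies each. -/
theorem error_ge_of_approxDP (p : GraphProblem) {N T n k R : ℕ} {ε δ α : ℝ} (hε : 0 ≤ ε)
    (hδ : 0 ≤ δ) (hN : 2 ≤ N) (hn : 0 < n) (hk : 0 < k)
    (hR : 150 * Real.exp p.leafCount ≤ R) (hkε : k * ε ≤ 1)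
    (hkN : n * k * (p.leafCount + 1) ≤ N)
    (hT : 2 * (n * k * p.leafCount) * (R ^ 2 * n ^ 2) ≤ T)
    (hδT : T * δ * Real.exp p.leafCount ≤ 1 / 2000)
    (A : ContinualAlg (Fin N) T (p.dim N))
    (hA : A.ItemLevelDP ε δ) (hacc : ∀ S, A.AccurateOn (p.value N) α (1 / 3) S) :
    n * k / 16 ≤ α := by
  by_contra! hα
  set g := p.leafCount
  have hM : 0 < n * k := Nat.mul_pos hn hk
  obtain ⟨d, hdn⟩ : ∃ d, d = R ^ 2 * n ^ 2 := ⟨_, rfl⟩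
  rw [← hdn] at hT
  obtain ⟨μ, hμ, hDP, hμacc⟩ := exists_countingMechanism p hε hδ hN hM hkN hT A hA hacc
  set copies : Finset (Fin n) → Finset (Fin (n * k)) := fun x =>
    (x ×ˢ (Finset.univ : Finset (Fin k))).map finProdFinEquiv.toEmbedding with hcopies
  have mem_copies : ∀ x σ, σ ∈ copies x ↔ (finProdFinEquiv.symm σ).1 ∈ x := fun x σ => by
    simp only [hcopies, Finset.mem_map_equiv, Finset.mem_product, Finset.mem_univ, and_true]
  have card_copies : ∀ x, ((copies x).card : ℝ) = x.card * k := fun x => by simp [hcopies]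
  have hn' : (0 : ℝ) < n := by exact_mod_cast hn
  have hk' : (0 : ℝ) < k := by exact_mod_cast hk
  have hE : 0 < Real.exp g := Real.exp_pos _
  have hR' : (0 : ℝ) < R := lt_of_lt_of_le (by positivity) hR
  -- Counts in `[0, n * k]` are rescaled to `[-1, 1]`, so error `n * k / 16` becomes `1 / 8`.
  -- Clamping brings an answer no further from a target in that interval.
  set f : (Fin d → ℝ) → Fin d → ℝ := fun y j => max (-1) (min 1 (2 / (n * k) * y j - 1))
  have hf : Measurable f := measurable_pi_lambda _ fun j =>
    measurable_const.max (measurable_const.min (((measurable_pi_apply j).const_mul _).sub_const _))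
  have hf1 : ∀ y j, |f y j| ≤ 1 := fun y j =>
    abs_le.2 ⟨le_max_left _ _, max_le (by norm_num) (min_le_left _ _)⟩
  have hd : (d : ℝ) = (R * n : ℝ) ^ 2 := by rw [hdn]; push_cast; ring
  have hkey := fingerprinting_bound (μ := fun X => μ fun j => copies (X j)) hn
    (r := R * n) (C := Real.exp g) (δ := k * g * Real.exp g * δ) (by positivity) hd hE.le hf hf1
    (fun i X X' hXX' O hO => by
      have h := hDP (copies {i}) (fun j => copies (X j)) (fun j => copies (X' j))
        (fun j σ hσ => by
          rw [mem_copies, Finset.mem_singleton] at hσ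
          rw [mem_copies, mem_copies]
          have h := Finset.ext_iff.1 (hXX' j) (finProdFinEquiv.symm σ).1
          rw [Finset.mem_erase, Finset.mem_erase] at h
          exact ⟨fun hm => (h.1 ⟨hσ, hm⟩).2, fun hm => (h.2 ⟨hσ, hm⟩).2⟩) O hO
      rw [card_copies, Finset.card_singleton, Nat.cast_one, one_mul] at h
      have hexp : Real.exp (k * g * ε) ≤ Real.exp g := Real.exp_le_exp.2 <| by
        calc (k * g * ε : ℝ) = g * (k * ε) := by ring
          _ ≤ g * 1 := by gcongr
          _ = g := mul_one _
      refine h.trans ?_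
      gcongr)
    (fun X => by
      refine (measureReal_mono ?_).trans (hμacc fun j => copies (X j))
      rintro y ⟨j, hj⟩
      refine ⟨j, ?_⟩
      by_contra! hle
      rw [card_copies] at hle
      refine absurd hj (not_lt.2 ?_)
      set x : ℝ := (2 * (X j).card - n : ℝ) / n with hx
      have hcard : ((X j).card : ℝ) ≤ n := by
        have := (X j).card_le_univ
        rw [Fintype.card_fin] at this
        exact_mod_cast this
      have hx1 : x ≤ 1 := by
        rw [hx, div_le_one hn']
        linarith
      have hx2 : -1 ≤ x := by
        rw [hx, le_div_iff₀ hn']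
        linarith [Nat.cast_nonneg (α := ℝ) (X j).card]
      have hclose : |2 / (n * k) * y j - 1 - x| ≤ 1 / 8 := by
        have e : 2 / (n * k) * y j - 1 - x = 2 / (n * k) * (y j - (X j).card * k) := by
          rw [hx]
          field_simp
          ring
        rw [e, abs_mul, abs_of_pos (by positivity)]
        calc 2 / (n * k) * |y j - (X j).card * k| ≤ 2 / (n * k) * (n * k / 16 : ℝ) := by
              gcongr
              exact hle.trans hα.le
          _ = 1 / 8 := by field_simp; norm_num
      rw [abs_le] at hclose ⊢
      simp only [f]
      constructor
      · rcases max_cases (-1) (min 1 (2 / (n * k) * y j - 1)) with h | h <;>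
          rcases min_cases 1 (2 / (n * k) * y j - 1) with h' | h' <;> linarith
      · rcases max_cases (-1) (min 1 (2 / (n * k) * y j - 1)) with h | h <;>
          rcases min_cases 1 (2 / (n * k) * y j - 1) with h' | h' <;> linarith)
  have hnkg : (n * k * g : ℝ) ≤ T := by
    have h1 : 1 ≤ d := by
      have : 0 < R := by exact_mod_cast hR'
      rw [hdn]
      exact Nat.succ_le_of_lt (by positivity)
    have : n * k * g ≤ T := by
      refine le_trans ?_ hT
      calc n * k * g ≤ 2 * (n * k * g) := by omega
        _ ≤ 2 * (n * k * g) * d := Nat.le_mul_of_pos_right _ h1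
    exact_mod_cast this
  have hsmall : (n * k * g : ℝ) * δ * Real.exp g ≤ 1 / 2000 := by
    refine le_trans ?_ hδT
    gcongr
  -- The two terms are at most `d / 150`, by the choice of `R`, and `d / 2000`, by the bound on `T *
  -- δ`. Their sum is less than `7/512 * d`.
  have h1 : n * (Real.exp g * (R * n) + d * (k * g * Real.exp g * δ))
      = Real.exp g * (R * n ^ 2) + d * ((n * k * g : ℝ) * δ * Real.exp g) := by ring
  have h2 : (d : ℝ) * ((n * k * g : ℝ) * δ * Real.exp g) ≤ d * (1 / 2000) := by gcongr
  have h3 : Real.exp g * (R * n ^ 2 : ℝ) ≤ R / 150 * (R * n ^ 2) := by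
    gcongr
    linarith
  have h4 : (R / 150 * (R * n ^ 2) : ℝ) = d / 150 := by rw [hd]; ring
  have h5 : (0 : ℝ) < d := by rw [hd]; positivity
  rw [h1] at hkey
  linarith

/-- The error of a purely private algorithm, by packing. -/
theorem error_ge_of_pureDP (p : GraphProblem) {N T k d : ℕ} {ε α : ℝ} (hε : 0 ≤ ε)
    (hN : 2 ≤ N) (hk : 0 < k) (hd : 0 < d) (hkε : k * p.leafCount * ε ≤ d / 4)
    (hkN : k * (p.leafCount + 1) ≤ N) (hT : 2 * (k * p.leafCount) * d ≤ T)
    (A : ContinualAlg (Fin N) T (p.dim N))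
    (hA : A.ItemLevelDP ε 0) (hacc : ∀ S, A.AccurateOn (p.value N) α (1 / 3) S) :
    k / 2 ≤ α := by
  by_contra! hα
  obtain ⟨μ, hμ, hDP, hμacc⟩ := exists_countingMechanism p hε le_rfl hN hk hkN hT A hA hacc
  set X : (Fin d → Bool) → Fin d → Finset (Fin k) := fun b j => if b j then Finset.univ else ∅
  set good : (Fin d → Bool) → Set (Fin d → ℝ) := fun b => {y | ∃ j, α < |y j - (X b j).card|}ᶜ
  have hbad : ∀ b, MeasurableSet {y : Fin d → ℝ | ∃ j, α < |y j - (X b j).card|} := fun b =>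
    measurableSet_exists_error measurable_id _ _
  have hgood : ∀ b, MeasurableSet (good b) := fun b => (hbad b).compl
  have hmass : ∀ b, 2 / 3 ≤ Real.exp (d / 4) * (μ (X fun _ => false)).real (good b) := by
    intro b
    have h1 : 2 / 3 ≤ (μ (X b)).real (good b) := by
      rw [probReal_compl_eq_one_sub (hbad b)]
      have := hμacc (X b)
      linarith
    have h2 := hDP Finset.univ (X b) (X fun _ => false) (fun j σ hσ => by simp at hσ)
      (good b) (hgood b)
    rw [mul_zero, add_zero, Finset.card_univ, Fintype.card_fin] at h2
    refine h1.trans (h2.trans ?_)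
    gcongr
  have hdisj : Pairwise fun b b' => Disjoint (good b) (good b') := by
    intro b b' hbb'
    obtain ⟨j, hj⟩ := Function.ne_iff.1 hbb'
    rw [Set.disjoint_left]
    intro y hy hy'
    simp only [good, Set.mem_compl_iff, Set.mem_ofPred_eq, not_exists, not_lt] at hy hy'
    have h := abs_le.1 (hy j)
    have h' := abs_le.1 (hy' j)
    cases hb : b j <;> cases hb' : b' j <;> simp [X, hb, hb'] at h h' hj <;> linarith
  have hsum : ∑ b, (μ (X fun _ => false)).real (good b) ≤ 1 := by
    have h := measureReal_biUnion_finset (μ := μ (X fun _ => false)) (s := Finset.univ) (f := good)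
      (fun b _ b' _ hbb' => hdisj hbb') fun b _ => hgood b
    rw [← h]
    exact measureReal_le_one
  have htotal : (2 : ℝ) ^ d * (2 / 3) ≤ Real.exp (d / 4) := by
    calc (2 : ℝ) ^ d * (2 / 3) = ∑ _b : Fin d → Bool, (2 / 3 : ℝ) := by simp
      _ ≤ ∑ b, Real.exp (d / 4) * (μ (X fun _ => false)).real (good b) :=
          Finset.sum_le_sum fun b _ => hmass b
      _ = Real.exp (d / 4) * ∑ b, (μ (X fun _ => false)).real (good b) :=
          (Finset.mul_sum _ _ _).symm
      _ ≤ Real.exp (d / 4) * 1 := by gcongr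
      _ = _ := mul_one _
  -- With `2 = 4/3 * 3/2`, the power of `3/2` absorbs the success probability `2/3`, leaving `(4/3)
  -- ^ d ≤ exp (d / 4)`, a contradiction.
  have hexp : Real.exp (1 / 4) < 4 / 3 := by
    have h : Real.exp (1 / 4) ^ 4 < (4 / 3 : ℝ) ^ 4 := by
      rw [← Real.exp_nat_mul]
      have := Real.exp_one_lt_d9
      norm_num at this ⊢
      linarith
    exact lt_of_pow_lt_pow_left₀ 4 (by norm_num) h
  have hpow : Real.exp (d / 4) < (4 / 3 : ℝ) ^ d := by
    have e : Real.exp (d / 4) = Real.exp (1 / 4) ^ d := by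
      rw [← Real.exp_nat_mul]
      ring_nf
    rw [e]
    exact pow_lt_pow_left₀ hexp (Real.exp_pos _).le hd.ne'
  have h32 : (3 / 2 : ℝ) ≤ (3 / 2 : ℝ) ^ d := le_self_pow₀ (by norm_num) hd.ne'
  have hmul : (2 : ℝ) ^ d = (4 / 3) ^ d * (3 / 2) ^ d := by
    rw [← mul_pow]; norm_num
  have h43 : (0 : ℝ) < (4 / 3) ^ d := by positivity
  nlinarith

/-! ### Choice of parameters. -/

lemma lt_two_mul_floor {x : ℝ} (hx : 1 ≤ x) : x < 2 * ⌊x⌋₊ := by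
  have h1 : 1 ≤ ⌊x⌋₊ := Nat.one_le_floor_iff _ |>.2 hx
  have h2 : (1 : ℝ) ≤ ⌊x⌋₊ := by exact_mod_cast h1
  linarith [Nat.lt_floor_add_one x]

/-- Three upper bounds that are at least one leave room for a natural number which is
at least half of one of them. -/
lemma exists_nat_between {x y z : ℝ} (hx : 1 ≤ x) (hy : 1 ≤ y) (hz : 1 ≤ z) :
    ∃ k : ℕ, 0 < k ∧ (k : ℝ) ≤ x ∧ (k : ℝ) ≤ y ∧ (k : ℝ) ≤ z ∧
      (x < 2 * k ∨ y < 2 * k ∨ z < 2 * k) := by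
  have h1 : 1 ≤ min (min x y) z := le_min (le_min hx hy) hz
  have hle := Nat.floor_le (zero_le_one.trans h1)
  have hlt := lt_two_mul_floor h1
  refine ⟨⌊min (min x y) z⌋₊, Nat.floor_pos.2 h1, hle.trans ((min_le_left _ _).trans
    (min_le_left _ _)), hle.trans ((min_le_left _ _).trans (min_le_right _ _)),
    hle.trans (min_le_right _ _), ?_⟩
  rcases min_choice (min x y) z with h | h
  · rcases min_choice x y with h' | h' <;> rw [h, h'] at hlt ⊢ <;> simp [hlt]
  · rw [h] at hlt ⊢
    simp [hlt]

/-- The number `n` of records and the number `k` of copies of each for approximate privacy. -/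
lemma exists_recordCount {ε : ℝ} (hε : 0 < ε) (hε1 : ε ≤ 1) {T N Q m : ℕ} (hQ : 0 < Q) (hm : 0 < m)
    (hT2 : 2 ≤ T) (hTQ : Q ≤ T) (hNm : m ≤ N) :
    ∃ n k : ℕ, 0 < n ∧ 0 < k ∧ k * ε ≤ 1 ∧ n * k * m ≤ N ∧ Q * n ^ 3 * k ≤ T ∧
      min (min ((T : ℝ) ^ (1 / 3 : ℝ) /
        (ε ^ (2 / 3 : ℝ) * (Real.logb 2 T) ^ (2 / 3 : ℝ))) (T : ℝ)) (N : ℝ)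
        ≤ 32 * Q * m * (n * k) := by
  have hQ' : (1 : ℝ) ≤ Q := by exact_mod_cast hQ
  have hm' : (1 : ℝ) ≤ m := by exact_mod_cast hm
  have hTQ' : (Q : ℝ) ≤ T := by exact_mod_cast hTQ
  have hNm' : (m : ℝ) ≤ N := by exact_mod_cast hNm
  have hT2' : (2 : ℝ) ≤ T := by exact_mod_cast hT2
  -- For very small `ε`, `1 / ε` copies do not fit. Then `k` alone is already of order `T` or `N`,
  -- which the minimum allows.
  obtain ⟨k, hk, hkε, hkT, hkN, hkmax⟩ := exists_nat_between (x := 1 / ε) (y := T / Q) (z := N / m)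
    ((one_le_div hε).2 hε1) ((one_le_div (by linarith)).2 hTQ') ((one_le_div (by linarith)).2 hNm')
  rw [le_div_iff₀ (by linarith)] at hkε hkT hkN
  rw [div_lt_iff₀ (by linarith), div_lt_iff₀ (by linarith), div_lt_iff₀ (by linarith)] at hkmax
  have hk' : (1 : ℝ) ≤ k := by exact_mod_cast hk
  set P : ℕ → Prop := fun n => n * k * m ≤ N ∧ Q * n ^ 3 * k ≤ T with hP
  have hP1 : P 1 := by
    constructor
    · rw [one_mul]; exact_mod_cast hkN
    · rw [one_pow, mul_one, mul_comm]; exact_mod_cast hkT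
  -- The number of records is taken where a constraint fails for `n + 1 ≤ 2 * n`, so it is tight up
  -- to a constant.
  obtain ⟨n, hn, hPn, hPn1⟩ : ∃ n, 0 < n ∧ P n ∧ ¬ P (n + 1) := by
    by_contra! h
    have hall : ∀ n, P (n + 1) := fun n => by
      induction n with
      | zero => exact hP1
      | succ n ih => exact h (n + 1) n.succ_pos ih
    have h1 := (hall N).1
    have h2 : (N + 1) * 1 * 1 ≤ (N + 1) * k * m :=
      Nat.mul_le_mul (Nat.mul_le_mul_left _ hk) hm
    omega
  refine ⟨n, k, hn, hk, hkε, hPn.1, hPn.2, ?_⟩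
  have hn' : (1 : ℝ) ≤ n := by exact_mod_cast hn
  have hQm : (1 : ℝ) ≤ Q * m := one_le_mul_of_one_le_of_one_le hQ' hm'
  have hnk : (k : ℝ) ≤ n * k := le_mul_of_one_le_left (by linarith) hn'
  have hN_of : (N : ℝ) ≤ 2 * (n * k) * m → (N : ℝ) ≤ 32 * Q * m * (n * k) := fun h => by
    refine h.trans ?_
    have : (0 : ℝ) ≤ n * k * m := by positivity
    nlinarith
  rcases not_and_or.1 hPn1 with h | h
  · refine (min_le_right _ _).trans (hN_of ?_)
    have h' : (N : ℝ) < (n + 1) * k * m := by exact_mod_cast not_le.1 h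
    have : ((n : ℝ) + 1) * k * m ≤ (2 * n) * k * m := by gcongr; linarith
    linarith
  have hTn : (T : ℝ) ≤ 8 * Q * n ^ 3 * k := by
    have h' : (T : ℝ) < Q * (n + 1) ^ 3 * k := by exact_mod_cast not_le.1 h
    have : (Q : ℝ) * (n + 1) ^ 3 * k ≤ Q * (2 * n) ^ 3 * k := by gcongr; linarith
    nlinarith
  rcases hkmax with h | h | h
  · refine (min_le_left _ _).trans ((min_le_left _ _).trans ?_)
    -- The logarithm only lowers the target, so it is replaced by one.
    have hlog : 1 ≤ Real.logb 2 T := by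
      rw [Real.le_logb_iff_rpow_le (by norm_num) (by linarith)]
      simpa using hT2'
    have hlog' : 1 ≤ (Real.logb 2 T) ^ (2 / 3 : ℝ) := Real.one_le_rpow hlog (by norm_num)
    have hεpos : 0 < ε ^ (2 / 3 : ℝ) := Real.rpow_pos_of_pos hε _
    have hT3 : ((T : ℝ) ^ (1 / 3 : ℝ)) ^ 3 = T := by
      rw [← Real.rpow_natCast, ← Real.rpow_mul (by linarith)]
      norm_num
    have hε3 : (ε ^ (2 / 3 : ℝ)) ^ 3 = ε ^ 2 := by
      rw [← Real.rpow_natCast, ← Real.rpow_mul hε.le]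
      norm_num
    calc (T : ℝ) ^ (1 / 3 : ℝ) / (ε ^ (2 / 3 : ℝ) * (Real.logb 2 T) ^ (2 / 3 : ℝ))
        ≤ (T : ℝ) ^ (1 / 3 : ℝ) / ε ^ (2 / 3 : ℝ) := by
          gcongr
          exact le_mul_of_one_le_right hεpos.le hlog'
      _ ≤ 32 * Q * m * (n * k) := by
          refine le_of_pow_le_pow_left₀ (n := 3) (by norm_num) (by positivity) ?_
          rw [div_pow, hT3, hε3, div_le_iff₀ (by positivity)]
          have hone : 1 ≤ 4 * (k * ε) ^ 2 := by nlinarith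
          have hb : (32 : ℝ) * Q ≤ (32 * Q * m) ^ 3 := by
            have h1 : (32 : ℝ) * Q ≤ 32 * Q * m := le_mul_of_one_le_right (by positivity) hm'
            refine h1.trans (le_self_pow₀ ?_ (by norm_num))
            linarith
          calc (T : ℝ) ≤ 8 * Q * n ^ 3 * k * 1 := by linarith
            _ ≤ 8 * Q * n ^ 3 * k * (4 * (k * ε) ^ 2) := by gcongr
            _ = 32 * Q * ((n * k) ^ 3 * ε ^ 2) := by ring
            _ ≤ (32 * Q * m) ^ 3 * ((n * k) ^ 3 * ε ^ 2) := by gcongr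
            _ = _ := by ring
  · refine (min_le_left _ _).trans ((min_le_right _ _).trans ?_)
    calc (T : ℝ) ≤ 2 * k * Q := h.le
      _ ≤ 2 * (n * k) * Q := by gcongr
      _ = 2 * Q * 1 * (n * k) := by ring
      _ ≤ 32 * Q * m * (n * k) := by gcongr; norm_num
  · refine (min_le_right _ _).trans (hN_of ?_)
    refine h.le.trans ?_
    gcongr

/-- The number `k` of copies for pure privacy. -/
lemma exists_copyCount {ε : ℝ} (hε : 0 < ε) (hε1 : ε ≤ 1) {T N g : ℕ} (hg : 0 < g)
    (hTg : 16 * g ^ 2 ≤ T) (hNg : g + 1 ≤ N) :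
    ∃ k d : ℕ, 0 < k ∧ 0 < d ∧ k * g * ε ≤ d / 4 ∧ k * (g + 1) ≤ N ∧ 2 * (k * g) * d ≤ T ∧
      min (min (Real.sqrt ((T : ℝ) / ε)) (T : ℝ)) (N : ℝ) ≤ 8 * (g + 1) * k := by
  have hg' : (1 : ℝ) ≤ g := by exact_mod_cast hg
  have hTg' : (16 : ℝ) * g ^ 2 ≤ T := by exact_mod_cast hTg
  have hNg' : (g : ℝ) + 1 ≤ N := by exact_mod_cast hNg
  have hT0 : (0 : ℝ) ≤ T := by positivity
  have hsq : Real.sqrt (T / ε) ^ 2 = T / ε := Real.sq_sqrt (by positivity)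
  have hsqrt : 4 * (g : ℝ) ≤ Real.sqrt (T / ε) := by
    refine Real.le_sqrt_of_sq_le ?_
    rw [le_div_iff₀ hε]
    nlinarith [sq_nonneg (g : ℝ)]
  obtain ⟨k, hk, hkT, hkS, hkN, hkmax⟩ := exists_nat_between (x := T / (4 * g))
    (y := Real.sqrt (T / ε) / (4 * g)) (z := N / (g + 1))
    ((one_le_div (by positivity)).2 (by nlinarith)) ((one_le_div (by positivity)).2 hsqrt)
    ((one_le_div (by positivity)).2 hNg')
  rw [le_div_iff₀ (by positivity)] at hkT hkS hkN
  rw [div_lt_iff₀ (by positivity), div_lt_iff₀ (by positivity), div_lt_iff₀ (by positivity)]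
    at hkmax
  have hk' : (1 : ℝ) ≤ k := by exact_mod_cast hk
  have hpos : 0 < 4 * (k * g * ε) := by positivity
  -- This is the least `d` that packing permits. Rounding up costs time at most `2 * k * g ≤ T / 2`,
  -- and the main part costs `8 * (k * g) ^ 2 * ε ≤ T / 2`.
  refine ⟨k, ⌈4 * (k * g * ε)⌉₊, hk, Nat.ceil_pos.2 hpos, ?_, by exact_mod_cast hkN, ?_, ?_⟩
  · linarith [Nat.le_ceil (4 * (k * g * ε))]
  · have hceil := Nat.ceil_lt_add_one hpos.le
    have h1 : (2 * (k * g) * ⌈4 * (k * g * ε)⌉₊ : ℝ) ≤ 2 * (k * g) * (4 * (k * g * ε) + 1) := by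
      gcongr
    have h2 : (k * (4 * g) : ℝ) ^ 2 * ε ≤ T := by
      rw [← le_div_iff₀ hε, ← hsq]
      gcongr
    have h3 : (2 * (k * g) * ⌈4 * (k * g * ε)⌉₊ : ℝ) ≤ T := by nlinarith
    exact_mod_cast h3
  · have hgk : (0 : ℝ) < g * k := by positivity
    rcases hkmax with h | h | h
    · refine (min_le_left _ _).trans ((min_le_right _ _).trans ?_)
      nlinarith
    · refine (min_le_left _ _).trans ((min_le_left _ _).trans ?_)
      nlinarith
    · refine (min_le_right _ _).trans ?_
      nlinarith

end DynamicGraphDP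

/-! ### Assembly of both bounds. -/

theorem mainTheorem7 (p : DynamicGraphDP.GraphProblem) :
    -- approximate differential privacy, where `δ` is a function of `T` with `δ = o(1/T)`
    (∃ c : ℝ, 0 < c ∧
      ∀ δ : ℕ → ℝ, (∀ T, 0 < δ T ∧ δ T < 1) →
        Asymptotics.IsLittleO Filter.atTop δ (fun T : ℕ => 1 / (T : ℝ)) →
        ∃ T₀ N₀ : ℕ, ∀ ε : ℝ, 0 < ε → ε ≤ 1 → ∀ T N : ℕ, T₀ ≤ T → N₀ ≤ N →
          ∀ (A : DynamicGraphDP.ContinualAlg (Fin N) T (p.dim N)) (α : ℝ),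
            A.ItemLevelDP ε (δ T) →
            (∀ S : DynamicGraphDP.DynGraphSeq (Fin N) T,
              A.AccurateOn (p.value N) α (1 / 3) S) →
            c * min (min ((T : ℝ) ^ (1 / 3 : ℝ) /
                (ε ^ (2 / 3 : ℝ) * (Real.logb 2 T) ^ (2 / 3 : ℝ))) (T : ℝ)) (N : ℝ) ≤ α) ∧
    -- pure differential privacy, `δ = 0`
    (∃ c : ℝ, 0 < c ∧
      ∃ T₀ N₀ : ℕ, ∀ ε : ℝ, 0 < ε → ε ≤ 1 → ∀ T N : ℕ, T₀ ≤ T → N₀ ≤ N →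
        ∀ (A : DynamicGraphDP.ContinualAlg (Fin N) T (p.dim N)) (α : ℝ),
          A.ItemLevelDP ε 0 →
          (∀ S : DynamicGraphDP.DynGraphSeq (Fin N) T,
            A.AccurateOn (p.value N) α (1 / 3) S) →
          c * min (min (Real.sqrt ((T : ℝ) / ε)) (T : ℝ)) (N : ℝ) ≤ α) := by
  have hg : 0 < p.leafCount := p.leafCount_pos
  constructor
  · set R := ⌈150 * Real.exp p.leafCount⌉₊
    have hR : 150 * Real.exp p.leafCount ≤ R := Nat.le_ceil _
    have hR0 : 0 < R := Nat.ceil_pos.2 (by positivity)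
    -- With this `Q`, the stream length `2 * (n * k * g) * (R ^ 2 * n ^ 2)` is `Q * n ^ 3 * k`. It
    -- depends on the problem only, and so does the constant.
    set Q := 2 * p.leafCount * R ^ 2
    have hQ : 0 < Q := by positivity
    refine ⟨1 / (16 * (32 * Q * (p.leafCount + 1 : ℕ))), by positivity, fun δ hδ hδo => ?_⟩
    have hb := hδo.bound (show (0 : ℝ) < 1 / (2000 * Real.exp p.leafCount) by positivity)
    obtain ⟨T₁, hT₁⟩ := Filter.eventually_atTop.1 hb
    refine ⟨max (max T₁ 2) Q, p.leafCount + 1, fun ε hε hε1 T N hT hN A α hA hacc => ?_⟩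
    have hTT₁ : T₁ ≤ T := (le_max_left _ _).trans ((le_max_left _ _).trans hT)
    have hT2 : 2 ≤ T := (le_max_right _ _).trans ((le_max_left _ _).trans hT)
    have hTQ : Q ≤ T := (le_max_right _ _).trans hT
    have hT0 : (0 : ℝ) < T := by exact_mod_cast (by omega : 0 < T)
    have hδT : T * δ T * Real.exp p.leafCount ≤ 1 / 2000 := by
      have h := hT₁ T hTT₁
      rw [Real.norm_of_nonneg (hδ T).1.le, Real.norm_of_nonneg (by positivity)] at h
      calc T * δ T * Real.exp p.leafCount
          ≤ T * (1 / (2000 * Real.exp p.leafCount) * (1 / T)) * Real.exp p.leafCount := by gcongr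
        _ = 1 / 2000 := by field_simp
    obtain ⟨n, k, hn, hk, hkε, hkN, hnT, hmin⟩ :=
      DynamicGraphDP.exists_recordCount hε hε1 hQ p.leafCount.succ_pos hT2 hTQ hN
    have hα := DynamicGraphDP.error_ge_of_approxDP p hε.le (hδ T).1.le (by omega) hn hk hR hkε hkN
      (le_trans (le_of_eq (by simp only [Q]; ring)) hnT) hδT A hA hacc
    refine le_trans ?_ hα
    calc _ ≤ 1 / (16 * (32 * Q * (p.leafCount + 1 : ℕ))) *
          (32 * Q * (p.leafCount + 1 : ℕ) * (n * k) : ℝ) := by gcongr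
      _ = n * k / 16 := by field_simp
  · refine ⟨1 / (16 * (p.leafCount + 1)), by positivity, 16 * p.leafCount ^ 2, p.leafCount + 1,
      fun ε hε hε1 T N hT hN A α hA hacc => ?_⟩
    obtain ⟨k, d, hk, hd, hkε, hkN, hkT, hmin⟩ :=
      DynamicGraphDP.exists_copyCount hε hε1 hg hT hN
    refine le_trans ?_ (DynamicGraphDP.error_ge_of_pureDP p hε.le (by omega) hk hd hkε hkN hkT
      A hA hacc)
    calc _ ≤ 1 / (16 * (p.leafCount + 1)) * (8 * (p.leafCount + 1) * k : ℝ) := by gcongr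
      _ = k / 2 := by field_simp; norm_num
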